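/- Let $p_1,p_2,r$ be positive integers with $p_1/p_2+p_2/p_1<r\le p:=p_1p_2$, and let $\varphi(A_1,\dots,A_r)=[\mathrm{vec}(A_1),\dots,\mathrm{vec}(A_r)]\in\mathbb R^{p\times r}$ for $A_i\in\mathbb R^{p_1\times p_2}$. A tuple $(A_1,\dots,A_r)$ is canonically decomposable if there are invertible $P\in\mathbb R^{p_1\times p_1}$, $Q\in\mathbb R^{p_2\times p_2}$ and $1\le a\le p_1-1$, $1\le b\le p_2-1$ such that every $PA_iQ^{-1}$ is block-diagonal with diagonal blocks of sizes $a\times b$ and $(p_1-a)\times(p_2-b)$. Let $\mathcal C_{p_1,p_2,r}\subset\mathbb R^{p\times r}$ be the embedded submanifold of all $\varphi(A_1,\dots,A_r)$ of rank $r$ such that $(A_1,\dots,A_r)$ is not canonically decomposable, $\sum_i A_iA_i^\top=p_2I_{p_1}$ and $\sum_i A_i^\top A_i=p_1I_{p_2}$, endowed with the Euclidean metric $g^E(U,V)=\mathrm{tr}(U^\top V)$. For $\tilde A=(A_1,\dots,A_r)$ put $a=[\mathrm{vec}(A_1)^\top,\dots,\mathrm{vec}(A_r)^\top]^\top$ and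 $$J(\tilde A)=\begin{bmatrix}\frac1p(I_{p_1^2}+K_{p_1})[A_1\otimes I_{p_1},\dots,A_r\otimes I_{p_1}]-\frac{2}{p_1^2p_2}\mathrm{vec}(I_{p_1})a^\top\\ \frac1p(I_{p_2^2}+K_{p_2})[I_{p_2}\otimes A_1^\top,\dots,I_{p_2}\otimes A_r^\top]-\frac{2}{p_1p_2^2}\mathrm{vec}(I_{p_2})a^\top\\ 2a^\top\end{bmatrix},$$ where $K_q$ is the commutation matrix, $K_q\mathrm{vec}(B^\top)=\mathrm{vec}(B)$ for $B\in\mathbb R^{q\times q}$. Let $M^\dagger$ denote the Moore–Penrose pseudoinverse of $M$. Let $f$ be a smooth real-valued function on $\mathcal C_{p_1,p_2,r}$, let $A\in\mathcal C_{p_1,p_2,r}$ and $V\in T_A\mathcal C_{p_1,p_2,r}$, and put $\tilde A=\varphi^{-1}(A)$, $\tilde V=\varphi^{-1}(V)$, $J=J(\tilde A)$. Let $\nabla f(A)$ and $\nabla^2 f(A)[V]$ be the Euclidean gradient and the Euclidean Hessian operator at $A$ of any smooth extension of $f$ to a neighbourhood of $A$ in $\mathbb R^{p\times r}$. Then the Riemannian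 gradient $\mathrm{grad} f(A)$ and the Riemannian Hessian operator $\mathrm{Hess} f(A)$ (the covariant derivative of $\mathrm{grad} f$ for the Levi-Civita connection) on $(\mathcal C_{p_1,p_2,r},g^E)$ are given by $$\mathrm{vec}(\mathrm{grad} f(A))=(I-J^\dagger J)\,\mathrm{vec}(\nabla f(A)),$$ $$\mathrm{vec}(\mathrm{Hess} f(A)[V])=(I-J^\dagger J)\,\mathrm{vec}(\nabla^2 f(A)[V])-(I-J^\dagger J)\,J(\tilde V)^\top (J^\dagger)^\top J^\dagger J\,\mathrm{vec}(\nabla f(A)).$$ -/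

import Mathlib

open Matrix Set
open scoped ContDiff Kronecker

attribute [local instance] Matrix.frobeniusNormedAddCommGroup Matrix.frobeniusNormedSpace

namespace KronCore

noncomputable section

/-! ### The Moore-Penrose pseudoinverse -/

/-- The four Penrose equations: `N` is a Moore-Penrose pseudoinverse of the real matrix `M`. -/
structure IsMoorePenrose {m n : Type*} [Fintype m] [Fintype n]
    (M : Matrix m n ℝ) (N : Matrix n m ℝ) : Prop where
  mul_mul_self : M * N * M = M
  self_mul_mul : N * M * N = N
  symm_left : (M * N)ᵀ = M * N
  symm_right : (N * M)ᵀ = N * M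

theorem IsMoorePenrose.unique {m n : Type*} [Fintype m] [Fintype n]
    {M : Matrix m n ℝ} {N N' : Matrix n m ℝ}
    (h : IsMoorePenrose M N) (h' : IsMoorePenrose M N') : N = N' := by
  have e1 : M * N = M * N' := by
    calc M * N = (M * N)ᵀ := h.symm_left.symm
      _ = ((M * N') * (M * N))ᵀ := by
        rw [show (M * N') * (M * N) = (M * N' * M) * N by simp only [Matrix.mul_assoc],
          h'.mul_mul_self]
      _ = (M * N) * (M * N') := by rw [transpose_mul, h.symm_left, h'.symm_left]
      _ = (M * N * M) * N' := by simp only [Matrix.mul_assoc]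
      _ = M * N' := by rw [h.mul_mul_self]
  have e2 : N * M = N' * M := by
    calc N * M = (N * M)ᵀ := h.symm_right.symm
      _ = ((N * M) * (N' * M))ᵀ := by
        rw [show (N * M) * (N' * M) = N * (M * N' * M) by simp only [Matrix.mul_assoc],
          h'.mul_mul_self]
      _ = (N' * M) * (N * M) := by rw [transpose_mul, h.symm_right, h'.symm_right]
      _ = N' * (M * N * M) := by simp only [Matrix.mul_assoc]
      _ = N' * M := by rw [h.mul_mul_self]
  calc N = N * M * N := h.self_mul_mul.symm
    _ = N' * (M * N) := by rw [e2, Matrix.mul_assoc]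
    _ = N' * M * N' := by rw [e1, Matrix.mul_assoc]
    _ = N' := h'.self_mul_mul

/-- A real symmetric matrix has a symmetric generalized inverse that commutes with it. -/
theorem exists_symm_ginv {n : Type*} [Fintype n] {H : Matrix n n ℝ} (hH : Hᵀ = H) :
    ∃ S : Matrix n n ℝ, Sᵀ = S ∧ H * S * H = H ∧ S * H * S = S ∧ S * H = H * S := by
  classical
  have hH' : H.IsHermitian := by
    rw [Matrix.IsHermitian, conjTranspose_eq_transpose_of_trivial, hH]
  obtain ⟨U, d, hU, hHU⟩ : ∃ (U : Matrix n n ℝ) (d : n → ℝ), Uᵀ * U = 1 ∧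
      H = U * diagonal d * Uᵀ := by
    refine ⟨hH'.eigenvectorUnitary, hH'.eigenvalues, ?_, ?_⟩
    · have := Unitary.coe_star_mul_self hH'.eigenvectorUnitary
      rwa [star_eq_conjTranspose, conjTranspose_eq_transpose_of_trivial] at this
    · have h := hH'.spectral_theorem
      rw [Unitary.conjStarAlgAut_apply, star_eq_conjTranspose,
        conjTranspose_eq_transpose_of_trivial] at h
      exact h
  have key : ∀ a b : n → ℝ, (U * diagonal a * Uᵀ) * (U * diagonal b * Uᵀ) =
      U * diagonal (fun i => a i * b i) * Uᵀ := by
    intro a b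
    calc (U * diagonal a * Uᵀ) * (U * diagonal b * Uᵀ)
        = U * diagonal a * (Uᵀ * U) * diagonal b * Uᵀ := by simp only [Matrix.mul_assoc]
      _ = _ := by rw [hU, Matrix.mul_one, Matrix.mul_assoc U, diagonal_mul_diagonal]
  refine ⟨U * diagonal (fun i => (d i)⁻¹) * Uᵀ, ?_, ?_, ?_, ?_⟩
  · simp only [transpose_mul, transpose_transpose, diagonal_transpose, Matrix.mul_assoc]
  · rw [hHU, key, key]
    congr 3
    funext i
    exact mul_inv_mul_cancel (d i)
  · rw [hHU, key, key]
    congr 3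
    funext i
    by_cases h : d i = 0
    · simp [h]
    · field_simp
  · rw [hHU, key, key]
    congr 3
    funext i
    exact mul_comm _ _

theorem exists_isMoorePenrose {m n : Type*} [Fintype m] [Fintype n]
    (M : Matrix m n ℝ) : ∃ N : Matrix n m ℝ, IsMoorePenrose M N := by
  classical
  obtain ⟨S, hS, hHSH, hSHS, hcomm⟩ := exists_symm_ginv (H := Mᵀ * M) (by simp)
  refine ⟨S * Mᵀ, ?_, ?_, ?_, ?_⟩
  · have h0 : (M * (S * (Mᵀ * M) - 1))ᴴ * (M * (S * (Mᵀ * M) - 1)) = 0 := by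
      rw [conjTranspose_eq_transpose_of_trivial, transpose_mul, Matrix.mul_assoc,
        ← Matrix.mul_assoc Mᵀ M, Matrix.mul_sub, Matrix.mul_one, ← Matrix.mul_assoc (Mᵀ * M) S,
        hHSH, sub_self, Matrix.mul_zero]
    have h1 := conjTranspose_mul_self_eq_zero.mp h0
    rw [Matrix.mul_sub, Matrix.mul_one, sub_eq_zero] at h1
    simpa only [Matrix.mul_assoc] using h1
  · calc S * Mᵀ * M * (S * Mᵀ) = S * (Mᵀ * M) * S * Mᵀ := by simp only [Matrix.mul_assoc]
      _ = S * Mᵀ := by rw [hSHS]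
  · simp only [transpose_mul, transpose_transpose, hS, Matrix.mul_assoc]
  · rw [Matrix.mul_assoc, transpose_mul, hS, transpose_mul, transpose_transpose, hcomm]

/-- The Moore-Penrose pseudoinverse of a real matrix, i.e. the unique solution of the Penrose
equations. -/
def pinv {m n : Type*} [Fintype m] [Fintype n] (M : Matrix m n ℝ) : Matrix n m ℝ :=
  (exists_isMoorePenrose M).choose

theorem pinv_spec {m n : Type*} [Fintype m] [Fintype n] (M : Matrix m n ℝ) :
    IsMoorePenrose M (pinv M) :=
  (exists_isMoorePenrose M).choose_spec

/-! ### Calculus in a space of matrices -/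

section Geometry

variable {m n : Type*} [Fintype m] [Fintype n]

/-- The Euclidean metric `g^E(U, V) = tr(Uᵀ V)`. -/
def gE (U V : Matrix m n ℝ) : ℝ := (Uᵀ * V).trace

/-- The Euclidean derivative `∇F(A)` of `F`, the matrix of the partial derivatives of `F`. -/
def euclGrad [DecidableEq m] [DecidableEq n] (F : Matrix m n ℝ → ℝ) (A : Matrix m n ℝ) :
    Matrix m n ℝ :=
  Matrix.of fun i j => fderiv ℝ F A (Matrix.single i j 1)

/-- The Euclidean Hessian operator `∇²F(A)[V]`, the directional derivative of `∇F` along `V`. -/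
def euclHess [DecidableEq m] [DecidableEq n] (F : Matrix m n ℝ → ℝ) (A V : Matrix m n ℝ) :
    Matrix m n ℝ :=
  fderiv ℝ (euclGrad F) A V

/-! ### Riemannian geometry of a subset `M` of a matrix space with the Euclidean metric

The notions below are meant for `M` an embedded submanifold, for which they are the usual ones.
Functions and vector fields on `M` are represented by functions on the whole space of which only
the values on `M` are relevant. -/

/-- `h` is a smooth function on `M`: near each point of `M` it agrees on `M` with a smooth function
on an open set of the ambient space. -/
def IsSmoothOn {G : Type*} [NormedAddCommGroup G] [NormedSpace ℝ G]
    (M : Set (Matrix m n ℝ)) (h : Matrix m n ℝ → G) : Prop :=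
  ∀ x ∈ M, ∃ U : Set (Matrix m n ℝ), IsOpen U ∧ x ∈ U ∧
    ∃ g : Matrix m n ℝ → G, ContDiffOn ℝ ∞ g U ∧ EqOn h g (M ∩ U)

/-- The tangent space `T_x M`: the velocities at `x` of smooth curves in `M` through `x`. -/
def tangentSpaceAt (M : Set (Matrix m n ℝ)) (x : Matrix m n ℝ) : Set (Matrix m n ℝ) :=
  {v | ∃ ε > 0, ∃ γ : ℝ → Matrix m n ℝ, ContDiffOn ℝ ∞ γ (Ioo (-ε) ε) ∧
    (∀ t ∈ Ioo (-ε) ε, γ t ∈ M) ∧ γ 0 = x ∧ HasDerivAt γ v 0}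

/-- The directional derivative `D_v h(x)` of a smooth function `h` on `M` along `v ∈ T_x M`.
Derivatives of `h` within `M` all agree on tangent vectors, so that this depends only on the values
of `h` on `M`, and it is the derivative of `h` along any curve in `M` with velocity `v` at `x`. -/
def dirDeriv (M : Set (Matrix m n ℝ)) (h : Matrix m n ℝ → ℝ) (x v : Matrix m n ℝ) : ℝ :=
  fderivWithin ℝ h M x v

/-- `X` is a smooth (tangent) vector field on `M`. -/
def IsVectorField (M : Set (Matrix m n ℝ)) (X : Matrix m n ℝ → Matrix m n ℝ) : Prop :=
  IsSmoothOn M X ∧ ∀ x ∈ M, X x ∈ tangentSpaceAt M x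

/-- The function `X h` on `M`, the derivative of the function `h` along the vector field `X`. -/
def lieDeriv (M : Set (Matrix m n ℝ)) (X : Matrix m n ℝ → Matrix m n ℝ)
    (h : Matrix m n ℝ → ℝ) : Matrix m n ℝ → ℝ :=
  fun x => dirDeriv M h x (X x)

/-- `D` (with `D X Y = ∇_X Y`) is the Riemannian (Levi-Civita) connection of `(M, g^E)`: an affine
connection on `M` that is torsion-free, `[X, Y] = ∇_X Y - ∇_Y X`, and compatible with the metric. -/
structure IsRiemannianConnection (M : Set (Matrix m n ℝ))
    (D : (Matrix m n ℝ → Matrix m n ℝ) → (Matrix m n ℝ → Matrix m n ℝ) →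
      (Matrix m n ℝ → Matrix m n ℝ)) : Prop where
  isVectorField : ∀ X Y, IsVectorField M X → IsVectorField M Y → IsVectorField M (D X Y)
  congr : ∀ X X' Y Y', IsVectorField M X → IsVectorField M X' → IsVectorField M Y →
    IsVectorField M Y' → EqOn X X' M → EqOn Y Y' M → EqOn (D X Y) (D X' Y') M
  add_left : ∀ X X' Y, IsVectorField M X → IsVectorField M X' → IsVectorField M Y →
    ∀ x ∈ M, D (fun y => X y + X' y) Y x = D X Y x + D X' Y x
  smul_left : ∀ (h : Matrix m n ℝ → ℝ) X Y, IsSmoothOn M h → IsVectorField M X →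
    IsVectorField M Y → ∀ x ∈ M, D (fun y => h y • X y) Y x = h x • D X Y x
  add_right : ∀ X Y Y', IsVectorField M X → IsVectorField M Y → IsVectorField M Y' →
    ∀ x ∈ M, D X (fun y => Y y + Y' y) x = D X Y x + D X Y' x
  leibniz : ∀ (h : Matrix m n ℝ → ℝ) X Y, IsSmoothOn M h → IsVectorField M X →
    IsVectorField M Y → ∀ x ∈ M,
      D X (fun y => h y • Y y) x = lieDeriv M X h x • Y x + h x • D X Y x
  torsion_free : ∀ (h : Matrix m n ℝ → ℝ) X Y, IsSmoothOn M h → IsVectorField M X →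
    IsVectorField M Y → ∀ x ∈ M,
      lieDeriv M X (lieDeriv M Y h) x - lieDeriv M Y (lieDeriv M X h) x =
        dirDeriv M h x (D X Y x - D Y X x)
  metric : ∀ X Y Z, IsVectorField M X → IsVectorField M Y → IsVectorField M Z → ∀ x ∈ M,
    lieDeriv M X (fun y => gE (Y y) (Z y)) x = gE (D X Y x) (Z x) + gE (Y x) (D X Z x)

/-- `W = grad f(x)`, the Riemannian gradient of `f` at `x` on `(M, g^E)`: the tangent vector with
`g^E(W, v) = D_v f(x)` for all tangent vectors `v`. -/
def IsRiemGradAt (M : Set (Matrix m n ℝ)) (f : Matrix m n ℝ → ℝ) (x W : Matrix m n ℝ) : Prop :=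
  W ∈ tangentSpaceAt M x ∧ ∀ v ∈ tangentSpaceAt M x, gE W v = dirDeriv M f x v

/-- `H = Hess f(x)[v]`, the Riemannian Hessian operator of `f` at `x` on `(M, g^E)` applied to the
tangent vector `v`: the covariant derivative at `x` of the vector field `grad f` along a vector
field through `v`, with respect to the Riemannian connection. -/
def IsRiemHessAt (M : Set (Matrix m n ℝ)) (f : Matrix m n ℝ → ℝ) (x v H : Matrix m n ℝ) : Prop :=
  ∃ D, IsRiemannianConnection M D ∧
    ∃ X G, IsVectorField M X ∧ X x = v ∧
      IsVectorField M G ∧ (∀ y ∈ M, IsRiemGradAt M f y (G y)) ∧ H = D X G x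

end Geometry

/-! ### The manifold of square roots of rank-`r` core covariance matrices

The rows of a `p × r` matrix, `p = p₁ p₂`, are indexed by `Fin p₂ × Fin p₁`, in accordance with
Mathlib's `Matrix.vec`, for which `vec B (j, i) = B i j` (the columns of `B` are stacked). -/

section Core

variable {p₁ p₂ r : ℕ}

/-- `φ(A₁, …, A_r) = [vec A₁, …, vec A_r]`. -/
def phi (p₁ p₂ r : ℕ) :
    (Fin r → Matrix (Fin p₁) (Fin p₂) ℝ) ≃ Matrix (Fin p₂ × Fin p₁) (Fin r) ℝ where
  toFun A := Matrix.of fun a k => vec (A k) a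
  invFun B := fun k => Matrix.of fun i j => B (j, i) k
  left_inv _ := rfl
  right_inv _ := rfl

/-- `A_R = ∑ A_i A_iᵀ`. -/
def rowGram (A : Fin r → Matrix (Fin p₁) (Fin p₂) ℝ) : Matrix (Fin p₁) (Fin p₁) ℝ :=
  ∑ k, A k * (A k)ᵀ

/-- `A_C = ∑ A_iᵀ A_i`. -/
def colGram (A : Fin r → Matrix (Fin p₁) (Fin p₂) ℝ) : Matrix (Fin p₂) (Fin p₂) ℝ :=
  ∑ k, (A k)ᵀ * A k

/-- `A` is canonically decomposable: for some invertible `P`, `Q` all the matrices `P A_i Q⁻¹` are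
block-diagonal with an upper left block of size `a × b` and a lower right block of size
`(p₁ - a) × (p₂ - b)`, where `1 ≤ a ≤ p₁ - 1` and `1 ≤ b ≤ p₂ - 1`. -/
def CanonicallyDecomposable (A : Fin r → Matrix (Fin p₁) (Fin p₂) ℝ) : Prop :=
  ∃ (P : GL (Fin p₁) ℝ) (Q : GL (Fin p₂) ℝ) (a b : ℕ),
    1 ≤ a ∧ a < p₁ ∧ 1 ≤ b ∧ b < p₂ ∧
    ∀ k (i : Fin p₁) (j : Fin p₂), (((i : ℕ) < a ∧ b ≤ (j : ℕ)) ∨ (a ≤ (i : ℕ) ∧ (j : ℕ) < b)) →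
      ((P : Matrix (Fin p₁) (Fin p₁) ℝ) * A k *
        ((Q⁻¹ : GL (Fin p₂) ℝ) : Matrix (Fin p₂) (Fin p₂) ℝ)) i j = 0

/-- The set `H` of the tuples `A` for which `φ(A)` has full rank, `A_R` and `A_C` are nonsingular,
and which are canonically indecomposable. -/
def setH (p₁ p₂ r : ℕ) : Set (Fin r → Matrix (Fin p₁) (Fin p₂) ℝ) :=
  {A | (phi p₁ p₂ r A).rank = min (p₁ * p₂) r ∧ (rowGram A).rank = p₁ ∧ (colGram A).rank = p₂ ∧
    ¬ CanonicallyDecomposable A}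

/-- `F(A) = (A_R / tr A_R, A_C / tr A_R, tr A_R)`. -/
def mapF (A : Fin r → Matrix (Fin p₁) (Fin p₂) ℝ) :
    Matrix (Fin p₁) (Fin p₁) ℝ × Matrix (Fin p₂) (Fin p₂) ℝ × ℝ :=
  ((rowGram A).trace⁻¹ • rowGram A, (rowGram A).trace⁻¹ • colGram A, (rowGram A).trace)

/-- `D = F⁻¹{(I / p₁, I / p₂, p)}`, a subset of `H`. -/
def setD (p₁ p₂ r : ℕ) : Set (Fin r → Matrix (Fin p₁) (Fin p₂) ℝ) :=
  {A | A ∈ setH p₁ p₂ r ∧ mapF A = ((p₁ : ℝ)⁻¹ • 1, (p₂ : ℝ)⁻¹ • 1, (p₁ : ℝ) * p₂)}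

/-- `C_{p₁,p₂,r} = φ(D)`. -/
def coreManifold (p₁ p₂ r : ℕ) : Set (Matrix (Fin p₂ × Fin p₁) (Fin r) ℝ) :=
  phi p₁ p₂ r '' setD p₁ p₂ r

/-- The commutation matrix `K`, with `K vec(Bᵀ) = vec(B)` for `B` of size `q × q`. -/
def commMat (q : ℕ) : Matrix (Fin q × Fin q) (Fin q × Fin q) ℝ :=
  Matrix.of fun x y => if y = x.swap then 1 else 0

/-- The block row `[A₁ ⊗ I, …, A_r ⊗ I]`. -/
def rowBlocks (A : Fin r → Matrix (Fin p₁) (Fin p₂) ℝ) :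
    Matrix (Fin p₁ × Fin p₁) (Fin r × (Fin p₂ × Fin p₁)) ℝ :=
  Matrix.of fun x c => (A c.1 ⊗ₖ (1 : Matrix (Fin p₁) (Fin p₁) ℝ)) x c.2

/-- The block row `[I ⊗ A₁ᵀ, …, I ⊗ A_rᵀ]`. -/
def colBlocks (A : Fin r → Matrix (Fin p₁) (Fin p₂) ℝ) :
    Matrix (Fin p₂ × Fin p₂) (Fin r × (Fin p₂ × Fin p₁)) ℝ :=
  Matrix.of fun x c => ((1 : Matrix (Fin p₂) (Fin p₂) ℝ) ⊗ₖ (A c.1)ᵀ) x c.2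

/-- The block `J₁(A)`; here `vec (phi A)` is the stacked vector `a` of the `vec A_i`. -/
def J₁ (A : Fin r → Matrix (Fin p₁) (Fin p₂) ℝ) :
    Matrix (Fin p₁ × Fin p₁) (Fin r × (Fin p₂ × Fin p₁)) ℝ :=
  (1 / ((p₁ : ℝ) * p₂)) • ((1 + commMat p₁) * rowBlocks A) -
    (2 / ((p₁ : ℝ) ^ 2 * p₂)) •
      vecMulVec (vec (1 : Matrix (Fin p₁) (Fin p₁) ℝ)) (vec (phi p₁ p₂ r A))

/-- The block `J₂(A)`. -/
def J₂ (A : Fin r → Matrix (Fin p₁) (Fin p₂) ℝ) :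
    Matrix (Fin p₂ × Fin p₂) (Fin r × (Fin p₂ × Fin p₁)) ℝ :=
  (1 / ((p₁ : ℝ) * p₂)) • ((1 + commMat p₂) * colBlocks A) -
    (2 / ((p₁ : ℝ) * p₂ ^ 2)) •
      vecMulVec (vec (1 : Matrix (Fin p₂) (Fin p₂) ℝ)) (vec (phi p₁ p₂ r A))

/-- The block `J₃(A) = 2 aᵀ`. -/
def J₃ (A : Fin r → Matrix (Fin p₁) (Fin p₂) ℝ) :
    Matrix Unit (Fin r × (Fin p₂ × Fin p₁)) ℝ :=
  Matrix.of fun _ c => 2 * vec (phi p₁ p₂ r A) c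

/-- The constraint Jacobian `J(A)`, the blocks `J₁(A)`, `J₂(A)`, `J₃(A)` on top of each other. -/
def constrJac (A : Fin r → Matrix (Fin p₁) (Fin p₂) ℝ) :
    Matrix ((Fin p₁ × Fin p₁) ⊕ (Fin p₂ × Fin p₂) ⊕ Unit) (Fin r × (Fin p₂ × Fin p₁)) ℝ :=
  fromRows (J₁ A) (fromRows (J₂ A) (J₃ A))

end Core

end

end KronCore

open KronCore

/-! The core manifold is locally the solution set of the quadratic equations `J(x) vec(x) = q`,
where `J` is linear in `x` and `J(x) vec(y)` is symmetric in `x` and `y`; the left side has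
differential `2 J(x)`. The equations are redundant, so `J(x)` is not of full row rank. What replaces
full rank is that the kernel of `J(x)ᵀ` is the same at every point of the manifold, and consists of
the dependencies that hold identically in `x` (`IsQuadric.ker`).

This is where indecomposability enters. Up to signs, a vector `z` in the kernel of `J(A)ᵀ` is a pair
of symmetric matrices with `S Aₖ = Aₖ T` for all `k` (`transpose_constrJac_mulVec_eq_zero_iff`). For
an indecomposable core tuple the spectral theorem makes both equal to the same scalar
(`IsCore.intertwiner_scalar`), and such a pair annihilates every tuple. Conversely a decomposable
core tuple has a nonscalar symmetric intertwiner (`IsCore.exists_intertwiner`); as the kernel of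
`J(y)ᵀ` cannot grow near `x`, indecomposability is an open condition on the solutions of the
equations (`isQuadric_coreManifold`).

Constancy of the kernel gives the tangent space `ker J(x)` by the inverse function theorem
(`IsQuadric.mem_tangentSpaceAt_iff`) and smoothness of the orthogonal projection `P = I - J†J` along
the manifold (`IsQuadric.isSmoothOn_kerProj`). The Levi-Civita connection is then `P` applied to the
Euclidean derivative, and it is unique (`IsTangentProjection.isRiemannianConnection`,
`IsTangentProjection.connection_unique`). Hence `grad f = P ∇F` and `Hess f [V] = P ∇²F[V] + P
(DP[V]) ∇F`. Differentiating `P² = P` and `J P = 0` and transposing gives `P DP[V] = -P J(V)ᵀ (J†)ᵀ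
J† J` (`IsQuadric.kerProj_mul_deriv`), which is the stated correction term. -/

namespace KronCore

/-- The topology of the Frobenius norm; it agrees with the product topology, but not up to
reducible unfolding, so that instance search has to be told which one to use. -/
@[reducible] noncomputable def frobeniusTopologicalSpace {m n : Type*} [Fintype m] [Fintype n] :
    TopologicalSpace (Matrix m n ℝ) :=
  Matrix.frobeniusNormedAddCommGroup.toPseudoMetricSpace.toUniformSpace.toTopologicalSpace

/-- The uniform structure of the Frobenius norm. -/
@[reducible] noncomputable def frobeniusUniformSpace {m n : Type*} [Fintype m] [Fintype n] :
    UniformSpace (Matrix m n ℝ) :=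
  Matrix.frobeniusNormedAddCommGroup.toPseudoMetricSpace.toUniformSpace

section Calculus

open scoped Topology

attribute [local instance] frobeniusUniformSpace frobeniusTopologicalSpace

variable {m n : Type*} [Fintype m] [Fintype n]
  {G : Type*} [NormedAddCommGroup G] [NormedSpace ℝ G]
  {G' : Type*} [NormedAddCommGroup G'] [NormedSpace ℝ G']
  {H : Type*} [NormedAddCommGroup H] [NormedSpace ℝ H]
  {M : Set (Matrix m n ℝ)} {x v : Matrix m n ℝ}

/-! ### Smooth functions on a subset of a matrix space -/

/-- This and the next three lemmas unfold the definitions under the local Frobenius instances, so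
that calculus lemmas elaborated with these instances apply. -/
theorem isSmoothOn_iff {h : Matrix m n ℝ → G} : IsSmoothOn M h ↔
    ∀ x ∈ M, ∃ U : Set (Matrix m n ℝ), IsOpen U ∧ x ∈ U ∧
      ∃ g : Matrix m n ℝ → G, ContDiffOn ℝ ∞ g U ∧ EqOn h g (M ∩ U) := Iff.rfl

theorem dirDeriv_eq (h : Matrix m n ℝ → ℝ) : dirDeriv M h x v = fderivWithin ℝ h M x v := rfl

theorem lieDeriv_eq (X : Matrix m n ℝ → Matrix m n ℝ) (h : Matrix m n ℝ → ℝ) :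
    lieDeriv M X h = fun x => fderivWithin ℝ h M x (X x) := rfl

theorem euclHess_eq [DecidableEq m] [DecidableEq n] (F : Matrix m n ℝ → ℝ) (A V : Matrix m n ℝ) :
    euclHess F A V = fderiv ℝ (euclGrad F) A V := rfl

theorem IsSmoothOn.congr {h h' : Matrix m n ℝ → G} (hh : IsSmoothOn M h) (he : EqOn h' h M) :
    IsSmoothOn M h' := by
  intro x hx
  obtain ⟨U, hU, hxU, g, hg, hgh⟩ := hh x hx
  exact ⟨U, hU, hxU, g, hg, fun y hy => (he hy.1).trans (hgh hy)⟩

theorem isSmoothOn_of_contDiff {h : Matrix m n ℝ → G} (hh : ContDiff ℝ ∞ h) : IsSmoothOn M h :=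
  fun _ _ => ⟨univ, isOpen_univ, mem_univ _, h, hh.contDiffOn, fun _ _ => rfl⟩

theorem IsSmoothOn.map₂ {h : Matrix m n ℝ → G} {h' : Matrix m n ℝ → G'} (hh : IsSmoothOn M h)
    (hh' : IsSmoothOn M h') {Φ : G × G' → H} (hΦ : ContDiff ℝ ∞ Φ) :
    IsSmoothOn M (fun y => Φ (h y, h' y)) := by
  rw [isSmoothOn_iff] at *
  intro x hx
  obtain ⟨U, hU, hxU, g, hg, hgh⟩ := hh x hx
  obtain ⟨U', hU', hxU', g', hg', hgh'⟩ := hh' x hx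
  refine ⟨U ∩ U', hU.inter hU', ⟨hxU, hxU'⟩, fun y => Φ (g y, g' y), ?_, ?_⟩
  · exact hΦ.comp_contDiffOn
      ((hg.mono inter_subset_left).prodMk (hg'.mono inter_subset_right))
  · rintro y ⟨hyM, hyU, hyU'⟩
    simp only [hgh ⟨hyM, hyU⟩, hgh' ⟨hyM, hyU'⟩]

theorem IsSmoothOn.hasFDerivWithinAt_of_eqOn {h g : Matrix m n ℝ → G} {U : Set (Matrix m n ℝ)}
    (hU : IsOpen U) (hxU : x ∈ U) (hx : x ∈ M) (hg : ContDiffOn ℝ ∞ g U)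
    (hgh : EqOn h g (M ∩ U)) : HasFDerivWithinAt h (fderiv ℝ g x) M x := by
  have h1 : HasFDerivAt g (fderiv ℝ g x) x :=
    ((hg.contDiffAt (hU.mem_nhds hxU)).differentiableAt (by simp)).hasFDerivAt
  refine h1.hasFDerivWithinAt.congr_of_eventuallyEq ?_ (hgh ⟨hx, hxU⟩)
  filter_upwards [self_mem_nhdsWithin, mem_nhdsWithin_of_mem_nhds (hU.mem_nhds hxU)] with y hy hyU
  exact hgh ⟨hy, hyU⟩

theorem IsSmoothOn.hasFDerivWithinAt {h : Matrix m n ℝ → G} (hh : IsSmoothOn M h) (hx : x ∈ M) :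
    HasFDerivWithinAt h (fderivWithin ℝ h M x) M x := by
  obtain ⟨U, hU, hxU, g, hg, hgh⟩ := isSmoothOn_iff.mp hh x hx
  exact (hasFDerivWithinAt_of_eqOn hU hxU hx hg hgh).differentiableWithinAt.hasFDerivWithinAt

/-- Both values are the derivative at `0` of `h ∘ γ` for a curve `γ` in `M` with velocity `v`. So
`fderivWithin` is meaningful on tangent vectors although derivatives within `M` are not unique. -/
theorem hasFDerivWithinAt_unique_of_tangent {h : Matrix m n ℝ → G} {L L' : Matrix m n ℝ →L[ℝ] G}
    (hL : HasFDerivWithinAt h L M x) (hL' : HasFDerivWithinAt h L' M x)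
    (hv : v ∈ tangentSpaceAt M x) : L v = L' v := by
  obtain ⟨ε, hε, γ, -, hγM, hγ0, hγ⟩ := hv
  have hmem : ∀ᶠ t in 𝓝 (0 : ℝ), γ t ∈ M := by
    filter_upwards [Ioo_mem_nhds (neg_lt_zero.mpr hε) hε] with t ht using hγM t ht
  subst hγ0
  exact (hL.comp_hasDerivAt (0 : ℝ) hγ hmem).unique (hL'.comp_hasDerivAt (0 : ℝ) hγ hmem)

theorem fderivWithin_eq_of_tangent {h : Matrix m n ℝ → G} {L : Matrix m n ℝ →L[ℝ] G}
    (hL : HasFDerivWithinAt h L M x) (hv : v ∈ tangentSpaceAt M x) :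
    fderivWithin ℝ h M x v = L v :=
  hasFDerivWithinAt_unique_of_tangent hL.differentiableWithinAt.hasFDerivWithinAt hL hv

theorem IsSmoothOn.fderivWithin_apply {h : Matrix m n ℝ → G} (hh : IsSmoothOn M h)
    {X : Matrix m n ℝ → Matrix m n ℝ} (hX : IsVectorField M X) :
    IsSmoothOn M (fun y => fderivWithin ℝ h M y (X y)) := by
  rw [isSmoothOn_iff]
  intro x hx
  obtain ⟨U, hU, hxU, g, hg, hgh⟩ := isSmoothOn_iff.mp hh x hx
  obtain ⟨U', hU', hxU', X', hX', hXX'⟩ := isSmoothOn_iff.mp hX.1 x hx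
  refine ⟨U ∩ U', hU.inter hU', ⟨hxU, hxU'⟩, fun y => fderiv ℝ g y (X' y), ?_, ?_⟩
  · exact ((hg.fderiv_of_isOpen hU (m := ∞) (by simp)).mono inter_subset_left).clm_apply
      (hX'.mono inter_subset_right)
  · rintro y ⟨hyM, hyU, hyU'⟩
    simp only
    rw [← hXX' ⟨hyM, hyU'⟩]
    exact fderivWithin_eq_of_tangent
      (IsSmoothOn.hasFDerivWithinAt_of_eqOn hU hyU hyM hg hgh) (hX.2 y hyM)

/-! ### The Euclidean metric -/

theorem gE_eq_dotProduct (U V : Matrix m n ℝ) : gE U V = vec U ⬝ᵥ vec V := by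
  rw [gE, vec_dotProduct_vec]

theorem gE_comm (U V : Matrix m n ℝ) : gE U V = gE V U := by
  simp only [gE_eq_dotProduct, dotProduct_comm]

/-- The Euclidean metric as a continuous bilinear map. -/
noncomputable def gEL : Matrix m n ℝ →L[ℝ] Matrix m n ℝ →L[ℝ] ℝ :=
  LinearMap.toContinuousBilinearMap
    (LinearMap.mk₂ ℝ gE (by intros; simp [gE, Matrix.add_mul])
      (by intros; simp [gE]) (by intros; simp [gE, Matrix.mul_add]) (by intros; simp [gE]))

theorem gEL_apply (U V : Matrix m n ℝ) : gEL U V = gE U V := rfl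

theorem gE_self_eq_zero {U : Matrix m n ℝ} : gE U U = 0 ↔ U = 0 := by
  rw [gE_eq_dotProduct, dotProduct_self_eq_zero, vec_eq_zero_iff]

theorem gE_sub_left (U U' V : Matrix m n ℝ) : gE (U - U') V = gE U V - gE U' V := by
  simp [← gEL_apply]

theorem gE_ext {U U' : Matrix m n ℝ} (h : ∀ V, gE U V = gE U' V) : U = U' := by
  rw [← sub_eq_zero, ← gE_self_eq_zero, gE_sub_left, h, sub_self]

theorem gE_euclGrad [DecidableEq m] [DecidableEq n] (F : Matrix m n ℝ → ℝ)
    (A V : Matrix m n ℝ) : gE (euclGrad F A) V = fderiv ℝ F A V := by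
  conv_rhs => rw [matrix_eq_sum_single V]
  simp only [map_sum]
  rw [gE_eq_dotProduct, vec_dotProduct_vec, Matrix.trace, Finset.sum_comm]
  simp only [diag_apply, mul_apply, transpose_apply]
  refine Finset.sum_congr rfl fun j _ => Finset.sum_congr rfl fun i _ => ?_
  rw [show single i j (V i j) = V i j • single i j (1 : ℝ) by simp, map_smul, smul_eq_mul,
    mul_comm]
  rfl

/-- The Riesz isomorphism of the Euclidean metric, as a continuous linear map. -/
noncomputable def rieszCLM [DecidableEq m] [DecidableEq n] :
    (Matrix m n ℝ →L[ℝ] ℝ) →L[ℝ] Matrix m n ℝ :=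
  LinearMap.toContinuousLinearMap
    { toFun := fun l => Matrix.of fun i j => l (single i j 1)
      map_add' := fun _ _ => rfl
      map_smul' := fun _ _ => rfl }

theorem euclGrad_eq_riesz [DecidableEq m] [DecidableEq n] (F : Matrix m n ℝ → ℝ) :
    euclGrad F = fun A => rieszCLM (fderiv ℝ F A) := rfl

theorem contDiffOn_euclGrad [DecidableEq m] [DecidableEq n] {F : Matrix m n ℝ → ℝ}
    {U : Set (Matrix m n ℝ)} (hU : IsOpen U) (hF : ContDiffOn ℝ ∞ F U) :
    ContDiffOn ℝ ∞ (euclGrad F) U := by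
  rw [euclGrad_eq_riesz]
  exact rieszCLM.contDiff.comp_contDiffOn (hF.fderiv_of_isOpen hU (m := ∞) (by simp))

end Calculus

section Connection

open scoped Topology

attribute [local instance] frobeniusUniformSpace frobeniusTopologicalSpace

variable {m n : Type*} [Fintype m] [Fintype n]
  {M : Set (Matrix m n ℝ)} {x u v w : Matrix m n ℝ}
  {P : Matrix m n ℝ → Matrix m n ℝ →L[ℝ] Matrix m n ℝ}

/-! ### The Levi-Civita connection from the tangential projection -/

/-- `P` is a smooth field of orthogonal projections onto the tangent spaces of `M`, with a symmetric
second fundamental form. -/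
structure IsTangentProjection (M : Set (Matrix m n ℝ))
    (P : Matrix m n ℝ → Matrix m n ℝ →L[ℝ] Matrix m n ℝ) : Prop where
  smooth : IsSmoothOn M P
  mem : ∀ x ∈ M, ∀ v, P x v ∈ tangentSpaceAt M x
  fix : ∀ x ∈ M, ∀ v ∈ tangentSpaceAt M x, P x v = v
  symm : ∀ x ∈ M, ∀ u v, gE (P x u) v = gE u (P x v)
  secondForm_symm : ∀ x ∈ M, ∀ u ∈ tangentSpaceAt M x, ∀ v ∈ tangentSpaceAt M x,
    fderivWithin ℝ P M x u v = fderivWithin ℝ P M x v u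

theorem IsTangentProjection.idem (hP : IsTangentProjection M P) (hx : x ∈ M) :
    P x (P x v) = P x v :=
  hP.fix x hx _ (hP.mem x hx v)

theorem IsTangentProjection.mem_iff (hP : IsTangentProjection M P) (hx : x ∈ M) :
    v ∈ tangentSpaceAt M x ↔ P x v = v :=
  ⟨hP.fix x hx v, fun h => h ▸ hP.mem x hx v⟩

theorem IsTangentProjection.sub_mem (hP : IsTangentProjection M P) (hx : x ∈ M)
    (hu : u ∈ tangentSpaceAt M x) (hv : v ∈ tangentSpaceAt M x) :
    u - v ∈ tangentSpaceAt M x := by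
  rw [hP.mem_iff hx] at *
  rw [map_sub, hu, hv]

theorem IsTangentProjection.isSmoothOn_apply (hP : IsTangentProjection M P)
    {Y : Matrix m n ℝ → Matrix m n ℝ} (hY : IsSmoothOn M Y) :
    IsSmoothOn M (fun y => P y (Y y)) :=
  hP.smooth.map₂ hY (Φ := fun q => q.1 q.2) (contDiff_fst.clm_apply contDiff_snd)

theorem IsTangentProjection.isVectorField (hP : IsTangentProjection M P)
    {Y : Matrix m n ℝ → Matrix m n ℝ} (hY : IsSmoothOn M Y) :
    IsVectorField M (fun y => P y (Y y)) :=
  ⟨hP.isSmoothOn_apply hY, fun x hx => hP.mem x hx _⟩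

theorem fderivWithin_clm_apply_tangent {Y : Matrix m n ℝ → Matrix m n ℝ}
    (hP : IsSmoothOn M P) (hY : IsSmoothOn M Y) (hx : x ∈ M) (hv : v ∈ tangentSpaceAt M x) :
    fderivWithin ℝ (fun y => P y (Y y)) M x v =
      P x (fderivWithin ℝ Y M x v) + fderivWithin ℝ P M x v (Y x) := by
  rw [fderivWithin_eq_of_tangent
    ((hP.hasFDerivWithinAt hx).clm_apply (hY.hasFDerivWithinAt hx)) hv]
  simp

theorem fderivWithin_congr_tangent {G : Type*} [NormedAddCommGroup G] [NormedSpace ℝ G]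
    {h h' : Matrix m n ℝ → G} (he : EqOn h h' M) (hx : x ∈ M) :
    fderivWithin ℝ h M x = fderivWithin ℝ h' M x :=
  fderivWithin_congr he (he hx)

/-- The tangential part of the derivative of a vector field. -/
noncomputable def projConnection (M : Set (Matrix m n ℝ))
    (P : Matrix m n ℝ → Matrix m n ℝ →L[ℝ] Matrix m n ℝ)
    (X Y : Matrix m n ℝ → Matrix m n ℝ) : Matrix m n ℝ → Matrix m n ℝ :=
  fun x => P x (fderivWithin ℝ Y M x (X x))

/-- For a local extension `g` of `h`, `X(Yh) = Dg(DY[X]) + D²g(X, Y)`, and the second term is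
symmetric. Differentiating `P Y = Y` splits `DY[X]` into `P DY[X]` and `DP[X] Y`; the latter is
symmetric as well, so only the projected derivatives survive in the commutator. -/
theorem IsTangentProjection.torsion_free (hP : IsTangentProjection M P) {h : Matrix m n ℝ → ℝ}
    {X Y : Matrix m n ℝ → Matrix m n ℝ} (hh : IsSmoothOn M h) (hX : IsVectorField M X)
    (hY : IsVectorField M Y) (hx : x ∈ M) :
    lieDeriv M X (lieDeriv M Y h) x - lieDeriv M Y (lieDeriv M X h) x =
      dirDeriv M h x (projConnection M P X Y x - projConnection M P Y X x) := by
  obtain ⟨U, hU, hxU, g, hg, hgh⟩ := isSmoothOn_iff.mp hh x hx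
  have hgx : ContDiffAt ℝ ∞ g x := hg.contDiffAt (hU.mem_nhds hxU)
  have hsymm : IsSymmSndFDerivAt ℝ g x := hgx.isSymmSndFDerivAt (by
    rw [minSmoothness_of_isRCLikeNormedField]; exact WithTop.coe_le_coe.mpr le_top)
  have hd2 : HasFDerivAt (fderiv ℝ g) (fderiv ℝ (fderiv ℝ g) x) x :=
    ((hgx.fderiv_right (m := 1) (by norm_cast)).differentiableAt (by simp)).hasFDerivAt
  have key : ∀ X Y : Matrix m n ℝ → Matrix m n ℝ, IsVectorField M X → IsVectorField M Y →
      lieDeriv M X (lieDeriv M Y h) x =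
        fderiv ℝ g x (fderivWithin ℝ Y M x (X x)) + fderiv ℝ (fderiv ℝ g) x (X x) (Y x) := by
    intro X Y hX hY
    have h1 : HasFDerivWithinAt (lieDeriv M Y h)
        ((fderiv ℝ g x) ∘L (fderivWithin ℝ Y M x) +
          (fderiv ℝ (fderiv ℝ g) x).flip (Y x)) M x := by
      have h2 := hd2.hasFDerivWithinAt.clm_apply (hY.1.hasFDerivWithinAt hx)
      have h3 : ∀ y ∈ M ∩ U, lieDeriv M Y h y = fderiv ℝ g y (Y y) := fun y hy =>
        fderivWithin_eq_of_tangent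
          (IsSmoothOn.hasFDerivWithinAt_of_eqOn hU hy.2 hy.1 hg hgh) (hY.2 y hy.1)
      refine h2.congr_of_eventuallyEq ?_ (h3 x ⟨hx, hxU⟩)
      filter_upwards [self_mem_nhdsWithin, mem_nhdsWithin_of_mem_nhds (hU.mem_nhds hxU)]
        with y hy hyU using h3 y ⟨hy, hyU⟩
    rw [lieDeriv_eq]
    simp only
    rw [fderivWithin_eq_of_tangent h1 (hX.2 x hx)]
    simp
  have hproj : ∀ X Y : Matrix m n ℝ → Matrix m n ℝ, IsVectorField M X → IsVectorField M Y →
      fderivWithin ℝ Y M x (X x) =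
        projConnection M P X Y x + fderivWithin ℝ P M x (X x) (Y x) := by
    intro X Y hX hY
    rw [projConnection, ← fderivWithin_clm_apply_tangent hP.smooth hY.1 hx (hX.2 x hx)]
    rw [fderivWithin_congr_tangent (fun y hy => (hP.fix y hy _ (hY.2 y hy)).symm) hx]
  rw [key X Y hX hY, key Y X hY hX, hsymm.eq (X x) (Y x), add_sub_add_right_eq_sub, ← map_sub,
    hproj X Y hX hY, hproj Y X hY hX, hP.secondForm_symm x hx _ (hX.2 x hx) _ (hY.2 x hx),
    add_sub_add_right_eq_sub, dirDeriv_eq]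
  exact (fderivWithin_eq_of_tangent (IsSmoothOn.hasFDerivWithinAt_of_eqOn hU hxU hx hg hgh)
    (hP.sub_mem hx (hP.mem x hx _) (hP.mem x hx _))).symm

theorem IsTangentProjection.isRiemannianConnection (hP : IsTangentProjection M P) :
    IsRiemannianConnection M (projConnection M P) where
  isVectorField X Y hX hY := hP.isVectorField (hY.1.fderivWithin_apply hX)
  congr X X' Y Y' _ _ _ _ hXX' hYY' x hx := by
    rw [projConnection, projConnection, fderivWithin_congr_tangent hYY' hx, hXX' hx]
  add_left X X' Y _ _ _ x _ := by simp [projConnection]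
  smul_left h X Y _ _ _ x _ := by simp [projConnection]
  add_right X Y Y' hX hY hY' x hx := by
    have h1 := (hY.1.hasFDerivWithinAt hx).add (hY'.1.hasFDerivWithinAt hx)
    have h2 := fderivWithin_eq_of_tangent h1 (hX.2 x hx)
    simp only [projConnection]
    rw [← map_add]
    exact congrArg (P x) h2
  leibniz h X Y hh hX hY x hx := by
    have h1 := (hh.hasFDerivWithinAt hx).smul (hY.1.hasFDerivWithinAt hx)
    have h2 := fderivWithin_eq_of_tangent h1 (hX.2 x hx)
    simp only [projConnection]
    refine (congrArg (P x) h2).trans ?_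
    simp only [_root_.add_apply, _root_.smul_apply,
      ContinuousLinearMap.smulRight_apply, map_add, map_smul, hP.fix x hx _ (hY.2 x hx)]
    rw [add_comm]
    rfl
  torsion_free h X Y hh hX hY x hx := hP.torsion_free hh hX hY hx
  metric X Y Z hX hY hZ x hx := by
    have h1 : HasFDerivWithinAt (fun y => gE (Y y) (Z y)) _ M x :=
      (gEL.hasFDerivAt.comp_hasFDerivWithinAt x (hY.1.hasFDerivWithinAt hx)).clm_apply
        (hZ.1.hasFDerivWithinAt hx)
    rw [lieDeriv_eq]
    simp only
    rw [fderivWithin_eq_of_tangent h1 (hX.2 x hx)]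
    simp only [projConnection]
    -- Since `Y x` and `Z x` are tangent and `P x` is self-adjoint, projecting the derivatives does
    -- not change their products with them.
    rw [hP.symm x hx, hP.fix x hx _ (hZ.2 x hx), ← hP.symm x hx, hP.fix x hx _ (hY.2 x hx),
      add_comm]
    rfl

theorem isSmoothOn_const (v : Matrix m n ℝ) : IsSmoothOn M (fun _ : Matrix m n ℝ => v) :=
  isSmoothOn_of_contDiff contDiff_const

theorem IsTangentProjection.torsion_unique (hP : IsTangentProjection M P)
    {D D' : (Matrix m n ℝ → Matrix m n ℝ) → (Matrix m n ℝ → Matrix m n ℝ) →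
      (Matrix m n ℝ → Matrix m n ℝ)}
    (hD : IsRiemannianConnection M D) (hD' : IsRiemannianConnection M D')
    {X Y : Matrix m n ℝ → Matrix m n ℝ} (hX : IsVectorField M X) (hY : IsVectorField M Y)
    (hx : x ∈ M) : D X Y x - D Y X x = D' X Y x - D' Y X x := by
  refine gE_ext fun V => ?_
  -- The torsion identity tested on linear functions recovers the vector itself.
  set l : Matrix m n ℝ →L[ℝ] ℝ := gEL.flip V
  have hl : IsSmoothOn M l := isSmoothOn_of_contDiff l.contDiff
  have h1 := hD.torsion_free l X Y hl hX hY x hx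
  rw [hD'.torsion_free l X Y hl hX hY x hx, dirDeriv_eq, dirDeriv_eq,
    fderivWithin_eq_of_tangent l.hasFDerivAt.hasFDerivWithinAt
      (hP.sub_mem hx ((hD.isVectorField X Y hX hY).2 x hx) ((hD.isVectorField Y X hY hX).2 x hx)),
    fderivWithin_eq_of_tangent l.hasFDerivAt.hasFDerivWithinAt
      (hP.sub_mem hx ((hD'.isVectorField X Y hX hY).2 x hx)
        ((hD'.isVectorField Y X hY hX).2 x hx))] at h1
  exact h1.symm

/-- The Koszul argument: the difference of two connections is symmetric in `X, Y` by
torsion-freeness and, paired with `Z`, antisymmetric in `Y, Z` by metricity. Alternating the two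
symmetries six times returns the trilinear form to its negative. -/
theorem IsTangentProjection.connection_unique (hP : IsTangentProjection M P)
    {D D' : (Matrix m n ℝ → Matrix m n ℝ) → (Matrix m n ℝ → Matrix m n ℝ) →
      (Matrix m n ℝ → Matrix m n ℝ)}
    (hD : IsRiemannianConnection M D) (hD' : IsRiemannianConnection M D')
    {X Y : Matrix m n ℝ → Matrix m n ℝ} (hX : IsVectorField M X) (hY : IsVectorField M Y)
    (hx : x ∈ M) : D X Y x = D' X Y x := by
  have hsymm : ∀ X Y Z : Matrix m n ℝ → Matrix m n ℝ, IsVectorField M X → IsVectorField M Y →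
      gE (D X Y x - D' X Y x) (Z x) = gE (D Y X x - D' Y X x) (Z x) := by
    intro X Y Z hX hY
    have := hP.torsion_unique hD hD' hX hY hx
    congr 1
    rw [sub_eq_sub_iff_add_eq_add] at *
    rw [this, add_comm]
  have hanti : ∀ X Y Z : Matrix m n ℝ → Matrix m n ℝ, IsVectorField M X → IsVectorField M Y →
      IsVectorField M Z →
      gE (D X Y x - D' X Y x) (Z x) = - gE (D X Z x - D' X Z x) (Y x) := by
    intro X Y Z hX hY hZ
    have h1 := hD.metric X Y Z hX hY hZ x hx
    rw [hD'.metric X Y Z hX hY hZ x hx] at h1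
    rw [gE_sub_left, gE_sub_left, gE_comm (D X Z x), gE_comm (D' X Z x)]
    linarith
  -- The projection extends the difference vector at `x` to a vector field, so that the difference
  -- can be paired with itself.
  set Z : Matrix m n ℝ → Matrix m n ℝ := fun y => P y (D X Y x - D' X Y x) with hZdef
  have hZ : IsVectorField M Z := hP.isVectorField (isSmoothOn_const _)
  have hZx : Z x = D X Y x - D' X Y x :=
    hP.fix x hx _ (hP.sub_mem hx ((hD.isVectorField X Y hX hY).2 x hx)
      ((hD'.isVectorField X Y hX hY).2 x hx))
  have h0 : gE (D X Y x - D' X Y x) (Z x) = 0 := by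
    have e1 := hanti X Y Z hX hY hZ
    have e2 := hsymm X Z Y hX hZ
    have e3 := hanti Z X Y hZ hX hY
    have e4 := hsymm Z Y X hZ hY
    have e5 := hanti Y Z X hY hZ hX
    have e6 := hsymm Y X Z hY hX
    linarith
  rw [hZx, gE_self_eq_zero, sub_eq_zero] at h0
  exact h0

/-! ### Riemannian gradient and Hessian -/

variable [DecidableEq m] [DecidableEq n]

theorem IsTangentProjection.isRiemGradAt_iff (hP : IsTangentProjection M P)
    {f F : Matrix m n ℝ → ℝ} {U : Set (Matrix m n ℝ)} (hU : IsOpen U)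
    (hF : ContDiffOn ℝ ∞ F U) (hFf : EqOn F f (M ∩ U)) (hx : x ∈ M) (hxU : x ∈ U)
    {W : Matrix m n ℝ} : IsRiemGradAt M f x W ↔ W = P x (euclGrad F x) := by
  have hd : ∀ v ∈ tangentSpaceAt M x, dirDeriv M f x v = gE (euclGrad F x) v := by
    intro v hv
    rw [gE_euclGrad, dirDeriv_eq, fderivWithin_eq_of_tangent
      (IsSmoothOn.hasFDerivWithinAt_of_eqOn hU hxU hx hF hFf.symm) hv]
  constructor
  · rintro ⟨hW, h⟩
    refine gE_ext fun V => ?_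
    rw [hP.symm x hx, ← hd _ (hP.mem x hx V), ← h _ (hP.mem x hx V), ← hP.symm x hx,
      hP.fix x hx W hW]
  · rintro rfl
    refine ⟨hP.mem x hx _, fun v hv => ?_⟩
    rw [hP.symm x hx, hP.fix x hx v hv, hd v hv]

/-- Gradients are chosen pointwise, with arbitrary values off `M`; smoothness comes from the local
formula `P ∇F`. -/
theorem IsTangentProjection.exists_gradient (hP : IsTangentProjection M P)
    {f : Matrix m n ℝ → ℝ} (hf : IsSmoothOn M f) :
    ∃ Γ : Matrix m n ℝ → Matrix m n ℝ, IsVectorField M Γ ∧ ∀ y ∈ M, IsRiemGradAt M f y (Γ y) := by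
  have hex : ∀ y : Matrix m n ℝ, ∃ W, y ∈ M → IsRiemGradAt M f y W := by
    intro y
    by_cases hy : y ∈ M
    · obtain ⟨U, hU, hyU, F, hF, hFf⟩ := isSmoothOn_iff.mp hf y hy
      exact ⟨_, fun _ => (hP.isRiemGradAt_iff hU hF hFf.symm hy hyU).mpr rfl⟩
    · exact ⟨0, fun h => absurd h hy⟩
  choose Γ hΓ using hex
  refine ⟨Γ, ⟨isSmoothOn_iff.mpr fun x hx => ?_, fun x hx => (hΓ x hx).1⟩, hΓ⟩
  obtain ⟨U, hU, hxU, F, hF, hFf⟩ := isSmoothOn_iff.mp hf x hx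
  obtain ⟨U', hU', hxU', P', hP', hPP'⟩ := isSmoothOn_iff.mp hP.smooth x hx
  refine ⟨U ∩ U', hU.inter hU', ⟨hxU, hxU'⟩, fun y => P' y (euclGrad F y), ?_, ?_⟩
  · exact (hP'.mono inter_subset_right).clm_apply
      ((contDiffOn_euclGrad hU hF).mono inter_subset_left)
  · rintro y ⟨hyM, hyU, hyU'⟩
    simp only
    rw [← hPP' ⟨hyM, hyU'⟩]
    exact (hP.isRiemGradAt_iff hU hF hFf.symm hyM hyU).mp (hΓ y hyM)

theorem IsTangentProjection.isRiemHessAt_iff (hP : IsTangentProjection M P)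
    {f F : Matrix m n ℝ → ℝ} (hf : IsSmoothOn M f) {U : Set (Matrix m n ℝ)} (hU : IsOpen U)
    (hF : ContDiffOn ℝ ∞ F U) (hFf : EqOn F f (M ∩ U)) (hx : x ∈ M) (hxU : x ∈ U)
    (hv : v ∈ tangentSpaceAt M x) {W : Matrix m n ℝ} :
    IsRiemHessAt M f x v W ↔
      W = P x (euclHess F x v) + P x (fderivWithin ℝ P M x v (euclGrad F x)) := by
  have key : ∀ Γ : Matrix m n ℝ → Matrix m n ℝ, (∀ y ∈ M, IsRiemGradAt M f y (Γ y)) →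
      P x (fderivWithin ℝ Γ M x v) =
        P x (euclHess F x v) + P x (fderivWithin ℝ P M x v (euclGrad F x)) := by
    intro Γ hΓ
    have hΓF : ∀ y ∈ M ∩ U, Γ y = P y (euclGrad F y) := fun y hy =>
      (hP.isRiemGradAt_iff hU hF hFf hy.1 hy.2).mp (hΓ y hy.1)
    have h1 : HasFDerivAt (euclGrad F) (fderiv ℝ (euclGrad F) x) x :=
      (((contDiffOn_euclGrad hU hF).contDiffAt (hU.mem_nhds hxU)).differentiableAt
        (by simp)).hasFDerivAt
    have h2 := (hP.smooth.hasFDerivWithinAt hx).clm_apply h1.hasFDerivWithinAt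
    have h3 := h2.congr_of_eventuallyEq (f₁ := Γ) (by
      filter_upwards [self_mem_nhdsWithin, mem_nhdsWithin_of_mem_nhds (hU.mem_nhds hxU)]
        with y hy hyU using hΓF y ⟨hy, hyU⟩) (hΓF x ⟨hx, hxU⟩)
    rw [fderivWithin_eq_of_tangent h3 hv, euclHess_eq]
    simp [hP.idem hx]
  constructor
  · rintro ⟨D, hD, X, Γ, hX, hXx, hΓ, hΓgrad, rfl⟩
    rw [hP.connection_unique hD hP.isRiemannianConnection hX hΓ hx, projConnection, hXx,
      key Γ hΓgrad]
  · rintro rfl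
    obtain ⟨Γ, hΓ, hΓgrad⟩ := hP.exists_gradient hf
    -- Any tangent vector `v` at `x` extends to the vector field `y ↦ P y v`.
    refine ⟨projConnection M P, hP.isRiemannianConnection, fun y => P y v, Γ,
      hP.isVectorField (isSmoothOn_const _), hP.fix x hx v hv, hΓ, hΓgrad, ?_⟩
    rw [projConnection, hP.fix x hx v hv, key Γ hΓgrad]

end Connection

section Pinv

variable {k l : Type*} [Fintype k] [Fintype l]

/-! ### Orthogonal projections from the pseudoinverse -/

theorem transpose_pinv_mul_pinv_mul (A : Matrix k l ℝ) :
    (pinv A)ᵀ * pinv A * A = (pinv A)ᵀ := by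
  rw [Matrix.mul_assoc]
  conv_lhs => rw [← (pinv_spec A).symm_right]
  rw [← transpose_mul, (pinv_spec A).self_mul_mul]

section Kernel

variable [DecidableEq l]

/-- The orthogonal projection `1 - A† A` onto the kernel of `A`. -/
noncomputable def kerProj (A : Matrix k l ℝ) : Matrix l l ℝ := 1 - pinv A * A

theorem mul_kerProj (A : Matrix k l ℝ) : A * kerProj A = 0 := by
  rw [kerProj, Matrix.mul_sub, Matrix.mul_one, ← Matrix.mul_assoc, (pinv_spec A).mul_mul_self,
    sub_self]

theorem transpose_kerProj (A : Matrix k l ℝ) : (kerProj A)ᵀ = kerProj A := by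
  rw [kerProj, transpose_sub, transpose_one, (pinv_spec A).symm_right]

theorem kerProj_mul_self (A : Matrix k l ℝ) : kerProj A * kerProj A = kerProj A := by
  conv_lhs => enter [1]; rw [kerProj]
  rw [Matrix.sub_mul, Matrix.one_mul, Matrix.mul_assoc, mul_kerProj, Matrix.mul_zero, sub_zero]

theorem kerProj_mulVec_eq_self_iff (A : Matrix k l ℝ) (u : l → ℝ) :
    kerProj A *ᵥ u = u ↔ A *ᵥ u = 0 := by
  constructor
  · intro h
    rw [← h, mulVec_mulVec, mul_kerProj, zero_mulVec]
  · intro h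
    rw [kerProj, sub_mulVec, one_mulVec, ← mulVec_mulVec, h, mulVec_zero, sub_zero]

theorem kerProj_mul_transpose (A : Matrix k l ℝ) : kerProj A * Aᵀ = 0 := by
  rw [← transpose_kerProj, ← transpose_mul, mul_kerProj, transpose_zero]

end Kernel

variable [DecidableEq k]

/-- The orthogonal projection `1 - A A†` onto the kernel of `Aᵀ`. -/
noncomputable def cokerProj (A : Matrix k l ℝ) : Matrix k k ℝ := 1 - A * pinv A

theorem transpose_cokerProj (A : Matrix k l ℝ) : (cokerProj A)ᵀ = cokerProj A := by
  rw [cokerProj, transpose_sub, transpose_one, (pinv_spec A).symm_left]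

theorem cokerProj_mul (A : Matrix k l ℝ) : cokerProj A * A = 0 := by
  rw [cokerProj, Matrix.sub_mul, Matrix.one_mul, (pinv_spec A).mul_mul_self, sub_self]

theorem transpose_mul_cokerProj (A : Matrix k l ℝ) : Aᵀ * cokerProj A = 0 := by
  rw [← transpose_cokerProj, ← transpose_mul, cokerProj_mul, transpose_zero]

theorem cokerProj_mul_self (A : Matrix k l ℝ) : cokerProj A * cokerProj A = cokerProj A := by
  conv_lhs => enter [2]; rw [cokerProj]
  rw [Matrix.mul_sub, Matrix.mul_one, ← Matrix.mul_assoc, cokerProj_mul, Matrix.zero_mul,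
    sub_zero]

theorem cokerProj_mulVec_of_mem_ker {A : Matrix k l ℝ} {z : k → ℝ} (h : Aᵀ *ᵥ z = 0) :
    cokerProj A *ᵥ z = z := by
  rw [← transpose_cokerProj, cokerProj, transpose_sub, transpose_one, transpose_mul, sub_mulVec,
    one_mulVec, ← mulVec_mulVec, h, mulVec_zero, sub_zero]

theorem transpose_mul_cokerProj_of_ker_le {A B : Matrix k l ℝ}
    (h : ∀ z, Aᵀ *ᵥ z = 0 → Bᵀ *ᵥ z = 0) : Bᵀ * cokerProj A = 0 := by
  refine ext_of_mulVec_single fun i => ?_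
  rw [← mulVec_mulVec, zero_mulVec]
  refine h _ ?_
  rw [mulVec_mulVec, transpose_mul_cokerProj, zero_mulVec]

/-- The quadratic form of the matrix is `|Bᵀz|² + |Cz|²` with `C` the projection onto `ker Aᵀ`. If
it vanishes then `z` lies in `ker Bᵀ ≤ ker Aᵀ`, so `z = Cz = 0`. -/
theorem isUnit_gram_add_cokerProj {A B : Matrix k l ℝ}
    (h : ∀ z, Bᵀ *ᵥ z = 0 → Aᵀ *ᵥ z = 0) : IsUnit (B * Bᵀ + cokerProj A) := by
  rw [← mulVec_injective_iff_isUnit, ← coe_mulVecLin, injective_iff_map_eq_zero]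
  intro z hz
  rw [mulVecLin_apply] at hz
  have h1 : z ⬝ᵥ (B * Bᵀ + cokerProj A) *ᵥ z =
      (Bᵀ *ᵥ z) ⬝ᵥ (Bᵀ *ᵥ z) + (cokerProj A *ᵥ z) ⬝ᵥ (cokerProj A *ᵥ z) := by
    rw [add_mulVec, dotProduct_add]
    congr 1
    · rw [← mulVec_mulVec, dotProduct_mulVec, ← mulVec_transpose]
    · conv_lhs => rw [← cokerProj_mul_self]
      rw [← mulVec_mulVec, dotProduct_mulVec, ← mulVec_transpose, transpose_cokerProj]
  rw [hz, dotProduct_zero] at h1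
  have h2 := dotProduct_self_star_nonneg (Bᵀ *ᵥ z)
  have h3 := dotProduct_self_star_nonneg (cokerProj A *ᵥ z)
  simp only [star_trivial] at h2 h3
  have h4 : (Bᵀ *ᵥ z) ⬝ᵥ (Bᵀ *ᵥ z) = 0 := by linarith
  have h5 : (cokerProj A *ᵥ z) ⬝ᵥ (cokerProj A *ᵥ z) = 0 := by linarith
  rw [dotProduct_self_eq_zero] at h4 h5
  rw [← cokerProj_mulVec_of_mem_ker (h z h4), h5]

/-- For `z` in `ker Bᵀ`, both summands annihilate `z - Cz`, hence `z = Cz` lies in `ker Aᵀ`.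
Invertibility being open, this bounds the kernel at nearby points. -/
theorem ker_le_of_isUnit_gram_add_cokerProj {A B : Matrix k l ℝ}
    (hB : Bᵀ * cokerProj A = 0) (hU : IsUnit (B * Bᵀ + cokerProj A)) {z : k → ℝ}
    (hz : Bᵀ *ᵥ z = 0) : Aᵀ *ᵥ z = 0 := by
  have hw : z - cokerProj A *ᵥ z = 0 := by
    have hinj := mulVec_injective_iff_isUnit.mpr hU
    apply hinj
    have h1 : Bᵀ *ᵥ (z - cokerProj A *ᵥ z) = 0 := by
      rw [mulVec_sub, hz, mulVec_mulVec, hB, zero_mulVec, sub_zero]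
    have h2 : cokerProj A *ᵥ (z - cokerProj A *ᵥ z) = 0 := by
      rw [mulVec_sub, mulVec_mulVec, cokerProj_mul_self, sub_self]
    simp only [mulVec_zero, add_mulVec, ← mulVec_mulVec, h1, h2, add_zero]
  rw [sub_eq_zero] at hw
  rw [hw, mulVec_mulVec, transpose_mul_cokerProj, zero_mulVec]

/-- With `A` fixed, the left side is visibly smooth in `B`, unlike the pseudoinverse. The identity
holds because `(B Bᵀ + C)(B†)ᵀ = B`, using `C B = 0`. -/
theorem transpose_mul_inv_mul_eq {A B : Matrix k l ℝ} (hB : Bᵀ * cokerProj A = 0)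
    (hU : IsUnit (B * Bᵀ + cokerProj A)) :
    Bᵀ * (B * Bᵀ + cokerProj A)⁻¹ * B = pinv B * B := by
  have hB' : cokerProj A * B = 0 := by
    rw [← transpose_transpose (cokerProj A * B), transpose_mul, transpose_cokerProj, hB,
      transpose_zero]
  have h1 : (pinv B)ᵀ = B * pinv B * (pinv B)ᵀ := by
    conv_lhs => rw [← (pinv_spec B).self_mul_mul]
    rw [Matrix.mul_assoc, transpose_mul, (pinv_spec B).symm_left]
  have h2 : (B * Bᵀ + cokerProj A) * (pinv B)ᵀ = B := by
    rw [Matrix.add_mul, Matrix.mul_assoc, ← transpose_mul, (pinv_spec B).symm_right,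
      ← Matrix.mul_assoc, (pinv_spec B).mul_mul_self, h1, ← Matrix.mul_assoc,
      ← Matrix.mul_assoc (cokerProj A), hB', Matrix.zero_mul, Matrix.zero_mul, add_zero]
  have h3 : (B * Bᵀ + cokerProj A)⁻¹ * B = (pinv B)ᵀ := by
    conv_lhs => enter [2]; rw [← h2]
    rw [nonsing_inv_mul_cancel_left _ _ ((isUnit_iff_isUnit_det _).mp hU)]
  rw [Matrix.mul_assoc, h3, ← transpose_mul, (pinv_spec B).symm_right]

end Pinv

section MatrixCalculus

open scoped Topology

attribute [local instance] frobeniusUniformSpace frobeniusTopologicalSpace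

variable {k l j m n : Type*} [Fintype k] [Fintype l] [Fintype j] [Fintype m] [Fintype n]
  {E : Type*} [NormedAddCommGroup E] [NormedSpace ℝ E]

/-! ### Calculus with matrix products -/

/-- Matrix multiplication as a continuous bilinear map. -/
noncomputable def mulCLM : Matrix k l ℝ →L[ℝ] Matrix l j ℝ →L[ℝ] Matrix k j ℝ :=
  LinearMap.toContinuousBilinearMap
    (LinearMap.mk₂ ℝ (fun A B => A * B) (by intros; simp [Matrix.add_mul])
      (by intros; simp) (by intros; simp [Matrix.mul_add]) (by intros; simp))

/-- Transposition as a continuous linear map. -/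
noncomputable def transposeCLM : Matrix k l ℝ →L[ℝ] Matrix l k ℝ :=
  LinearMap.toContinuousLinearMap
    { toFun := fun A => Aᵀ
      map_add' := fun _ _ => rfl
      map_smul' := fun _ _ => rfl }

theorem contDiffOn_matrix_mul {N : WithTop ℕ∞} {U : Set E} {a : E → Matrix k l ℝ}
    {b : E → Matrix l j ℝ} (ha : ContDiffOn ℝ N a U) (hb : ContDiffOn ℝ N b U) :
    ContDiffOn ℝ N (fun y => a y * b y) U :=
  (mulCLM (k := k) (l := l) (j := j)).contDiff.comp_contDiffOn ha |>.clm_apply hb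

theorem contDiffOn_matrix_inv [DecidableEq k] {N : WithTop ℕ∞} {U : Set E} {a : E → Matrix k k ℝ}
    (ha : ContDiffOn ℝ N a U) (hU : ∀ y ∈ U, IsUnit (a y)) :
    ContDiffOn ℝ N (fun y => (a y)⁻¹) U := by
  -- The Frobenius norm is submultiplicative, so smoothness of inversion at units of a complete
  -- normed algebra applies.
  let _ : NormedRing (Matrix k k ℝ) := Matrix.frobeniusNormedRing
  let _ : NormedAlgebra ℝ (Matrix k k ℝ) := Matrix.frobeniusNormedAlgebra
  have : CompleteSpace (Matrix k k ℝ) := FiniteDimensional.complete ℝ _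
  intro y hy
  simp_rw [nonsing_inv_eq_ringInverse]
  have h1 : ContDiffAt ℝ N (Ring.inverse : Matrix k k ℝ → Matrix k k ℝ) (a y) :=
    contDiffAt_ringInverse ℝ (hU y hy).unit
  exact h1.comp_contDiffWithinAt y (ha y hy)

/-- Vectorization as a linear equivalence. -/
noncomputable def vecEquiv {m n : Type*} : Matrix m n ℝ ≃ₗ[ℝ] (n × m → ℝ) :=
  LinearEquiv.ofBijective
    { toFun := vec, map_add' := fun _ _ => rfl, map_smul' := fun _ _ => rfl } vec_bijective

theorem vec_vecEquiv_symm {m n : Type*} (u : n × m → ℝ) : vec (vecEquiv.symm u : Matrix m n ℝ) = u :=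
  vecEquiv.apply_symm_apply u

/-- The endomorphism of a matrix space given by a matrix acting on vectorizations. -/
noncomputable def matAct :
    Matrix (n × m) (n × m) ℝ →L[ℝ] Matrix m n ℝ →L[ℝ] Matrix m n ℝ :=
  LinearMap.toContinuousBilinearMap
    (LinearMap.mk₂ ℝ (fun R v => vecEquiv.symm (R *ᵥ vec v))
      (by intros; simp [add_mulVec]) (by intros; simp [smul_mulVec])
      (by intros; simp [mulVec_add]) (by intros; simp [mulVec_smul]))

theorem vec_matAct (R : Matrix (n × m) (n × m) ℝ) (v : Matrix m n ℝ) :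
    vec (matAct R v) = R *ᵥ vec v := vec_vecEquiv_symm _

theorem isOpen_setOf_isUnit_comp {E n : Type*} [TopologicalSpace E] [Fintype n] [DecidableEq n]
    {Q : E → Matrix n n ℝ} (hQ : Continuous Q) : IsOpen {y | IsUnit (Q y)} := by
  have h1 : {y | IsUnit (Q y)} = (fun y => (Q y).det) ⁻¹' {0}ᶜ := by
    ext y
    simp [isUnit_iff_isUnit_det]
  rw [h1]
  exact isOpen_compl_singleton.preimage (Continuous.matrix_det hQ)

theorem continuous_gram {E k l : Type*} [TopologicalSpace E] [Fintype k] [Fintype l]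
    {a : E → Matrix k l ℝ} (ha : Continuous a) : Continuous fun y => a y * (a y)ᵀ :=
  ((mulCLM (k := k) (l := l) (j := k)).continuous.comp ha).clm_apply
    ((transposeCLM (k := k) (l := l)).continuous.comp ha)

end MatrixCalculus

/-! ### Curves from the inverse function theorem -/

/-- A map with invertible derivative has smooth local sections along straight lines. -/
theorem exists_curve_of_hasFDerivAt {E : Type*} [NormedAddCommGroup E] [NormedSpace ℝ E]
    [CompleteSpace E] {Φ : E → E} (hΦ : ContDiff ℝ ω Φ) {x v : E} (hx : Φ x = 0) {f' : E ≃L[ℝ] E}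
    (hf' : HasFDerivAt Φ (f' : E →L[ℝ] E) x) (hv : f' v = v) {U : Set E}
    (hU : U ∈ nhds x) :
    ∃ ε > 0, ∃ γ : ℝ → E, ContDiffOn ℝ ∞ γ (Ioo (-ε) ε) ∧ γ 0 = x ∧ HasDerivAt γ v 0 ∧
      ∀ t ∈ Ioo (-ε) ε, Φ (γ t) = t • v ∧ γ t ∈ U := by
  have hne : (ω : WithTop ℕ∞) ≠ 0 := by simp
  have hs : HasStrictFDerivAt Φ (f' : E →L[ℝ] E) x := hΦ.contDiffAt.hasStrictFDerivAt' hf' hne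
  set g : E → E := hs.localInverse Φ f' x with hg
  have hg0 : g 0 = x := by rw [← hx]; exact hs.localInverse_apply_image
  have hgd : HasFDerivAt g (f'.symm : E →L[ℝ] E) 0 := by
    rw [← hx]; exact hs.to_localInverse.hasFDerivAt
  have hgs : ContDiffAt ℝ ω g 0 := by
    rw [← hx]; exact hΦ.contDiffAt.to_localInverse hf' hne
  -- Order `ω` at a point persists on a neighbourhood. Order `∞` at a point would not suffice, as
  -- its neighbourhoods may shrink with the order of differentiation.
  have h1 : ∀ᶠ y in nhds (0 : E), ContDiffAt ℝ ω g y := hgs.eventually (by simp)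
  have h2 : ∀ᶠ y in nhds (0 : E), Φ (g y) = y := by
    have := hs.eventually_right_inverse
    rwa [hx] at this
  have h3 : ∀ᶠ y in nhds (0 : E), g y ∈ U :=
    hgs.continuousAt.eventually (by rw [hg0]; exact hU)
  have hl : Filter.Tendsto (fun t : ℝ => t • v) (nhds 0) (nhds 0) := by
    have : Continuous fun t : ℝ => t • v := by fun_prop
    simpa using this.tendsto 0
  obtain ⟨ε, hε, hball⟩ := Metric.eventually_nhds_iff_ball.mp
    (hl.eventually (h1.and (h2.and h3)))
  have hmem : ∀ t ∈ Ioo (-ε) ε, t ∈ Metric.ball (0 : ℝ) ε := by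
    intro t ht
    rw [Real.ball_eq_Ioo]
    simpa using ht
  refine ⟨ε, hε, fun t => g (t • v), ?_, ?_, ?_, fun t ht => (hball t (hmem t ht)).2⟩
  · intro t ht
    have hlin : ContDiffAt ℝ ∞ (fun t : ℝ => t • v) t := by fun_prop
    exact (((hball t (hmem t ht)).1.of_le le_top).comp t hlin).contDiffWithinAt
  · simpa using hg0
  · have hlin : HasDerivAt (fun t : ℝ => t • v) v 0 := by
      simpa using (hasDerivAt_id (0 : ℝ)).smul_const v
    have hgd' : HasFDerivAt g (f'.symm : E →L[ℝ] E) ((0 : ℝ) • v) := by simpa using hgd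
    have := hgd'.comp_hasDerivAt (0 : ℝ) hlin
    have hv' : f'.symm v = v := by rw [ContinuousLinearEquiv.symm_apply_eq, hv]
    rw [ContinuousLinearEquiv.coe_coe, hv'] at this
    exact this

section Quadric

open scoped Topology

attribute [local instance] frobeniusUniformSpace frobeniusTopologicalSpace

variable {m n k : Type*} [Fintype m] [Fintype n] [Fintype k]
  {M : Set (Matrix m n ℝ)} {J : Matrix m n ℝ →ₗ[ℝ] Matrix k (n × m) ℝ} {q : k → ℝ}
  {x u v : Matrix m n ℝ}

/-! ### Submanifolds cut out by quadratic equations -/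

/-- `M` is locally cut out by the equations `J(x) vec(x) = q`, where `J` is the polarization of a
quadratic map, and every linear dependence of the differentials of the equations at a point of `M`
is a dependence of the equations. -/
structure IsQuadric (M : Set (Matrix m n ℝ)) (J : Matrix m n ℝ →ₗ[ℝ] Matrix k (n × m) ℝ)
    (q : k → ℝ) : Prop where
  symm : ∀ x y, J x *ᵥ vec y = J y *ᵥ vec x
  eqn : ∀ x ∈ M, J x *ᵥ vec x = q
  isOpen : ∀ x ∈ M, ∃ U : Set (Matrix m n ℝ), IsOpen U ∧ x ∈ U ∧
    ∀ y ∈ U, J y *ᵥ vec y = q → y ∈ M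
  ker : ∀ x ∈ M, ∀ z, (J x)ᵀ *ᵥ z = 0 → ∀ y, (J y)ᵀ *ᵥ z = 0

/-- The polarization as a continuous bilinear map. -/
noncomputable def polarCLM (J : Matrix m n ℝ →ₗ[ℝ] Matrix k (n × m) ℝ) :
    Matrix m n ℝ →L[ℝ] Matrix m n ℝ →L[ℝ] (k → ℝ) :=
  LinearMap.toContinuousBilinearMap
    (LinearMap.mk₂ ℝ (fun x v => J x *ᵥ vec v)
      (by intros; simp [add_mulVec]) (by intros; simp [smul_mulVec])
      (by intros; simp [mulVec_add]) (by intros; simp [mulVec_smul]))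

theorem polarCLM_apply {k : Type*} (J : Matrix m n ℝ →ₗ[ℝ] Matrix k (n × m) ℝ) (x v : Matrix m n ℝ) :
    polarCLM J x v = J x *ᵥ vec v := rfl

/-- The adjoint of `J(x)` as a continuous linear map. -/
noncomputable def adjCLM (A : Matrix k (n × m) ℝ) : (k → ℝ) →L[ℝ] Matrix m n ℝ :=
  LinearMap.toContinuousLinearMap (vecEquiv.symm.toLinearMap ∘ₗ (Aᵀ).mulVecLin)

theorem vec_adjCLM (A : Matrix k (n × m) ℝ) (z : k → ℝ) : vec (adjCLM A z) = Aᵀ *ᵥ z :=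
  vec_vecEquiv_symm _

theorem IsQuadric.hasFDerivAt (hM : IsQuadric M J q) (x : Matrix m n ℝ) :
    HasFDerivAt (fun y => polarCLM J y y) ((2 : ℝ) • polarCLM J x) x := by
  have h := (polarCLM J).hasFDerivAt.clm_apply (hasFDerivAt_id x)
  refine h.congr_fderiv ?_
  ext v : 1
  simp only [id_eq, ContinuousLinearMap.comp_id, _root_.add_apply, ContinuousLinearMap.flip_apply,
    two_smul]
  rw [polarCLM_apply J v x, hM.symm v x, polarCLM_apply]

theorem fderivWithin_matrix_mul_tangent {k l j : Type*} [Fintype k] [Fintype l] [Fintype j]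
    {a : Matrix m n ℝ → Matrix k l ℝ} {b : Matrix m n ℝ → Matrix l j ℝ}
    (ha : IsSmoothOn M a) (hb : IsSmoothOn M b) (hx : x ∈ M) (hv : v ∈ tangentSpaceAt M x) :
    fderivWithin ℝ (fun y => a y * b y) M x v =
      a x * fderivWithin ℝ b M x v + fderivWithin ℝ a M x v * b x := by
  have h1 : HasFDerivWithinAt (fun y => a y * b y) _ M x :=
    ((mulCLM (k := k) (l := l) (j := j)).hasFDerivAt.comp_hasFDerivWithinAt x
      (ha.hasFDerivWithinAt hx)).clm_apply (hb.hasFDerivWithinAt hx)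
  rw [fderivWithin_eq_of_tangent h1 hv]
  rfl

variable [DecidableEq m] [DecidableEq n]

theorem IsQuadric.mem_tangentSpaceAt_iff (hM : IsQuadric M J q) (hx : x ∈ M) :
    v ∈ tangentSpaceAt M x ↔ J x *ᵥ vec v = 0 := by
  classical
  constructor
  · intro hv
    have h1 := (hM.hasFDerivAt x).hasFDerivWithinAt (s := M)
    have h2 : HasFDerivWithinAt (fun y => polarCLM J y y) (0 : Matrix m n ℝ →L[ℝ] (k → ℝ)) M x :=
      (hasFDerivWithinAt_const q x M).congr (fun y hy => hM.eqn y hy) (hM.eqn x hx)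
    have h3 := hasFDerivWithinAt_unique_of_tangent h1 h2 hv
    simpa [polarCLM_apply] using h3
  · intro hv
    obtain ⟨U, hU, hxU, hUM⟩ := hM.isOpen x hx
    set Pk : Matrix m n ℝ →L[ℝ] Matrix m n ℝ := matAct (kerProj (J x)) with hPk
    set S : (k → ℝ) →L[ℝ] Matrix m n ℝ := adjCLM (J x) with hS
    -- The equations are pulled back by `J(x)ᵀ` and completed by the tangential coordinate `P(y -
    -- x)`. The derivative `P + 2 J(x)ᵀJ(x)` is injective and fixes `v`, so the inverse function
    -- theorem applies despite the redundancy of the equations.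
    set Φ : Matrix m n ℝ → Matrix m n ℝ := fun y => Pk (y - x) + S (polarCLM J y y - q) with hΦ
    set L : Matrix m n ℝ →L[ℝ] Matrix m n ℝ := Pk + S ∘L ((2 : ℝ) • polarCLM J x) with hL
    have hΦd : HasFDerivAt Φ L x :=
      (Pk.hasFDerivAt.comp x ((hasFDerivAt_id x).sub_const x)).add
        (S.hasFDerivAt.comp x ((hM.hasFDerivAt x).sub_const q))
    have hΦs : ContDiff ℝ ω Φ := by
      refine (Pk.contDiff.comp (contDiff_id.sub contDiff_const)).add
        (S.contDiff.comp (ContDiff.sub ?_ contDiff_const))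
      exact (polarCLM J).contDiff.clm_apply contDiff_id
    have hΦx : Φ x = 0 := by
      have : polarCLM J x x = q := hM.eqn x hx
      simp [hΦ, this]
    have hinj : Function.Injective (L : Matrix m n ℝ →ₗ[ℝ] Matrix m n ℝ) := by
      rw [injective_iff_map_eq_zero]
      intro w hw
      have hw' : kerProj (J x) *ᵥ vec w + (2 : ℝ) • ((J x)ᵀ *ᵥ (J x *ᵥ vec w)) = 0 := by
        have := congrArg vec hw
        simpa [hL, hPk, hS, vec_matAct, vec_adjCLM, polarCLM_apply, mulVec_smul] using this
      have h1 : kerProj (J x) *ᵥ vec w = 0 := by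
        have := congrArg (fun z => kerProj (J x) *ᵥ z) hw'
        simpa only [mulVec_add, mulVec_smul, mulVec_mulVec, kerProj_mul_self,
          kerProj_mul_transpose, ← Matrix.mul_assoc, Matrix.zero_mul, zero_mulVec, smul_zero,
          add_zero, mulVec_zero] using this
      rw [h1, zero_add, smul_eq_zero_iff_right two_ne_zero] at hw'
      have h2 : (J x *ᵥ vec w) ⬝ᵥ (J x *ᵥ vec w) = 0 := by
        rw [dotProduct_mulVec, ← mulVec_transpose, hw', zero_dotProduct]
      rw [dotProduct_self_eq_zero, ← kerProj_mulVec_eq_self_iff, h1] at h2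
      rwa [eq_comm, vec_eq_zero_iff] at h2
    have hkerv : kerProj (J x) *ᵥ vec v = vec v := (kerProj_mulVec_eq_self_iff _ _).mpr hv
    set f' : Matrix m n ℝ ≃L[ℝ] Matrix m n ℝ :=
      (LinearEquiv.ofInjectiveEndo (L : Matrix m n ℝ →ₗ[ℝ] Matrix m n ℝ)
        hinj).toContinuousLinearEquiv with hf'
    have hf'L : (f' : Matrix m n ℝ →L[ℝ] Matrix m n ℝ) = L := by ext1; rfl
    have hLv : f' v = v := by
      change L v = v
      apply vec_inj.mp
      simp [hL, hPk, vec_matAct, polarCLM_apply, hkerv, hv]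
    obtain ⟨ε, hε, γ, hγs, hγ0, hγd, hγ⟩ :=
      exists_curve_of_hasFDerivAt hΦs hΦx (f' := f') (by rw [hf'L]; exact hΦd) hLv
        (hU.mem_nhds hxU)
    refine ⟨ε, hε, γ, hγs, fun t ht => ?_, hγ0, hγd⟩
    obtain ⟨h1, h2⟩ := hγ t ht
    refine hUM _ h2 ?_
    set y := γ t
    have h3 : kerProj (J x) *ᵥ vec (y - x) + (J x)ᵀ *ᵥ (J y *ᵥ vec y - q) = t • vec v := by
      have := congrArg vec h1
      simpa only [hΦ, hPk, hS, vec_add, vec_matAct, vec_adjCLM, polarCLM_apply, vec_smul]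
        using this
    -- Applying `P` kills the `J(x)ᵀ` term and separates the two components.
    have h4 : kerProj (J x) *ᵥ vec (y - x) = t • vec v := by
      have := congrArg (fun z => kerProj (J x) *ᵥ z) h3
      simpa only [mulVec_add, mulVec_smul, mulVec_mulVec, kerProj_mul_self,
          kerProj_mul_transpose, ← Matrix.mul_assoc, Matrix.zero_mul, zero_mulVec, smul_zero,
          add_zero, hkerv] using this
    have h5 : (J x)ᵀ *ᵥ (J y *ᵥ vec y - q) = 0 := by
      rw [h4] at h3
      simpa using h3
    -- The residual `z = J(y) vec(y) - q` lies in `ker J(x)ᵀ`, hence in `ker J(y)ᵀ`. Writing `q =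
    -- J(x) vec(x)` makes `z` orthogonal to itself.
    have h6 : (J y *ᵥ vec y - q) ⬝ᵥ (J y *ᵥ vec y - q) = 0 := by
      conv_lhs => enter [2]; rw [← hM.eqn x hx]
      rw [dotProduct_sub, dotProduct_mulVec, dotProduct_mulVec, ← mulVec_transpose,
        ← mulVec_transpose, hM.ker x hx _ h5 y, h5]
      simp
    rw [dotProduct_self_eq_zero, sub_eq_zero] at h6
    exact h6

/-- The pseudoinverse is discontinuous where the rank jumps; the constant kernel of `J(y)ᵀ` excludes
this on `M` and allows `J†J = Jᵀ(J Jᵀ + C)⁻¹J` with `C` frozen at `x`. -/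
theorem IsQuadric.isSmoothOn_kerProj (hM : IsQuadric M J q) :
    IsSmoothOn M (fun y => kerProj (J y)) := by
  classical
  rw [isSmoothOn_iff]
  intro x hx
  have hcoker : ∀ y, (J y)ᵀ * cokerProj (J x) = 0 := fun y =>
    transpose_mul_cokerProj_of_ker_le fun z hz => hM.ker x hx z hz y
  have hJ : Continuous J := J.continuous_of_finiteDimensional
  set V : Set (Matrix m n ℝ) := {y | IsUnit (J y * (J y)ᵀ + cokerProj (J x))} with hV
  have hunit : ∀ y ∈ M, y ∈ V := fun y hy =>
    isUnit_gram_add_cokerProj fun z hz => hM.ker y hy z hz x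
  have hVopen : IsOpen V := isOpen_setOf_isUnit_comp ((continuous_gram hJ).add continuous_const)
  have hJs : ContDiffOn ℝ ∞ J V :=
    (LinearMap.toContinuousLinearMap J).contDiff.contDiffOn
  have hJt : ContDiffOn ℝ ∞ (fun y => (J y)ᵀ) V := 
    (transposeCLM (k := k) (l := n × m)).contDiff.comp_contDiffOn hJs
  refine ⟨V, hVopen, hunit x hx,
    fun y => 1 - (J y)ᵀ * (J y * (J y)ᵀ + cokerProj (J x))⁻¹ * J y, ?_, ?_⟩
  · exact contDiffOn_const.sub (contDiffOn_matrix_mul (contDiffOn_matrix_mul hJt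
      (contDiffOn_matrix_inv ((contDiffOn_matrix_mul hJs hJt).add contDiffOn_const)
        fun y hy => hy)) hJs)
  · rintro y ⟨hyM, hyV⟩
    simp only [kerProj]
    rw [transpose_mul_inv_mul_eq (hcoker y) hyV]

/-- With `K = DP[u]`, differentiating `P² = P` gives `P K P = 0`, and differentiating `J P = 0`
gives `J K = -J(u) P`. Insert `1 = P + J†J` to the left of `K P`. -/
theorem IsQuadric.deriv_kerProj_mul (hM : IsQuadric M J q) (hx : x ∈ M)
    (hu : u ∈ tangentSpaceAt M x) :
    fderivWithin ℝ (fun y => kerProj (J y)) M x u * kerProj (J x) =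
      -(pinv (J x) * J u * kerProj (J x)) := by
  set Pm := kerProj (J x) with hPm
  set K := fderivWithin ℝ (fun y => kerProj (J y)) M x u with hK
  have hPs := hM.isSmoothOn_kerProj
  have hJs : IsSmoothOn M J := isSmoothOn_of_contDiff (LinearMap.toContinuousLinearMap J).contDiff
  have h1 : K = Pm * K + K * Pm := by
    rw [hK, hPm, ← fderivWithin_matrix_mul_tangent hPs hPs hx hu]
    simp only [kerProj_mul_self]
  have hJu : fderivWithin ℝ J M x u = J u := fderivWithin_eq_of_tangent
    (LinearMap.toContinuousLinearMap J).hasFDerivAt.hasFDerivWithinAt hu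
  have h2 : J x * K + J u * Pm = 0 := by
    rw [hK, hPm, ← hJu, ← fderivWithin_matrix_mul_tangent hJs hPs hx hu]
    simp only [mul_kerProj]
    rw [fderivWithin_eq_of_tangent (hasFDerivWithinAt_const _ x M) hu]
    simp
  have hidem : Pm * Pm = Pm := kerProj_mul_self _
  have h3 : Pm * K * Pm = 0 := by
    have := congrArg (fun R => Pm * R) h1
    simp only [Matrix.mul_add, ← Matrix.mul_assoc, hidem] at this
    simpa using this
  have h4 : Pm + pinv (J x) * J x = 1 := by rw [hPm, kerProj]; abel
  calc K * Pm = (Pm + pinv (J x) * J x) * (K * Pm) := by rw [h4, Matrix.one_mul]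
    _ = Pm * K * Pm + pinv (J x) * (J x * K) * Pm := by
      simp only [Matrix.add_mul, Matrix.mul_assoc]
    _ = _ := by
      rw [h3, zero_add, eq_neg_of_add_eq_zero_left h2, Matrix.mul_neg, Matrix.neg_mul,
        Matrix.mul_assoc, Matrix.mul_assoc, hidem, Matrix.mul_assoc]

/-- The transpose of the preceding identity, since `P` and its derivative are symmetric. The
trailing `J†J` is absorbed by `(J†)ᵀ`. -/
theorem IsQuadric.kerProj_mul_deriv (hM : IsQuadric M J q) (hx : x ∈ M)
    (hu : u ∈ tangentSpaceAt M x) :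
    kerProj (J x) * fderivWithin ℝ (fun y => kerProj (J y)) M x u =
      -(kerProj (J x) * (J u)ᵀ * (pinv (J x))ᵀ * pinv (J x) * J x) := by
  have hsymm : (fderivWithin ℝ (fun y => kerProj (J y)) M x u)ᵀ =
      fderivWithin ℝ (fun y => kerProj (J y)) M x u := by
    have h1 := transposeCLM.hasFDerivAt.comp_hasFDerivWithinAt x
      (hM.isSmoothOn_kerProj.hasFDerivWithinAt hx)
    have h2 := fderivWithin_eq_of_tangent h1 hu
    have h3 : (transposeCLM ∘ fun y => kerProj (J y)) = fun y => kerProj (J y) := by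
      funext y
      exact transpose_kerProj _
    rw [h3] at h2
    exact h2.symm
  have h := congrArg transpose (hM.deriv_kerProj_mul hx hu)
  rw [transpose_mul, hsymm, transpose_kerProj, transpose_neg, transpose_mul, transpose_mul,
    transpose_kerProj] at h
  rw [h]
  conv_lhs => rw [← transpose_pinv_mul_pinv_mul]
  simp only [Matrix.mul_assoc]

/-- The field of orthogonal projections onto the tangent spaces of a quadric. -/
noncomputable def tangentProj (J : Matrix m n ℝ →ₗ[ℝ] Matrix k (n × m) ℝ) (x : Matrix m n ℝ) :
    Matrix m n ℝ →L[ℝ] Matrix m n ℝ := matAct (kerProj (J x))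

theorem IsQuadric.fderivWithin_tangentProj (hM : IsQuadric M J q) (hx : x ∈ M)
    (hu : u ∈ tangentSpaceAt M x) :
    fderivWithin ℝ (tangentProj J) M x u =
      matAct (fderivWithin ℝ (fun y => kerProj (J y)) M x u) :=
  fderivWithin_eq_of_tangent ((matAct (m := m) (n := n)).hasFDerivAt.comp_hasFDerivWithinAt x
    (hM.isSmoothOn_kerProj.hasFDerivWithinAt hx)) hu

theorem IsQuadric.isTangentProjection (hM : IsQuadric M J q) :
    IsTangentProjection M (tangentProj J) := by
  have hfix : ∀ x ∈ M, ∀ v ∈ tangentSpaceAt M x, kerProj (J x) *ᵥ vec v = vec v :=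
    fun x hx v hv =>
      (kerProj_mulVec_eq_self_iff _ _).mpr ((hM.mem_tangentSpaceAt_iff hx).mp hv)
  refine ⟨?_, ?_, ?_, ?_, ?_⟩
  · exact hM.isSmoothOn_kerProj.map₂ hM.isSmoothOn_kerProj (Φ := fun p => matAct p.1)
      ((matAct (m := m) (n := n)).contDiff.comp contDiff_fst)
  · intro x hx v
    rw [hM.mem_tangentSpaceAt_iff hx, tangentProj, vec_matAct, mulVec_mulVec, mul_kerProj,
      zero_mulVec]
  · intro x hx v hv
    apply vec_inj.mp
    rw [tangentProj, vec_matAct, hfix x hx v hv]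
  · intro x hx u v
    rw [gE_eq_dotProduct, gE_eq_dotProduct, tangentProj, vec_matAct, vec_matAct,
      dotProduct_mulVec, ← mulVec_transpose, transpose_kerProj]
  -- On tangent vectors `DP[u] v = -J† J(u) v`, whose symmetry is that of the polarization.
  · have key : ∀ x ∈ M, ∀ u ∈ tangentSpaceAt M x, ∀ v ∈ tangentSpaceAt M x,
        vec (fderivWithin ℝ (tangentProj J) M x u v) = -(pinv (J x) *ᵥ (J u *ᵥ vec v)) := by
      intro x hx u hu v hv
      rw [hM.fderivWithin_tangentProj hx hu, vec_matAct]
      conv_lhs => rw [← hfix x hx v hv]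
      rw [mulVec_mulVec, hM.deriv_kerProj_mul hx hu, neg_mulVec, ← mulVec_mulVec,
        hfix x hx v hv, mulVec_mulVec]
    intro x hx u hu v hv
    apply vec_inj.mp
    rw [key x hx u hu v hv, key x hx v hv u hu, hM.symm]

theorem IsQuadric.isRiemGradAt_iff (hM : IsQuadric M J q) {f F : Matrix m n ℝ → ℝ}
    {U : Set (Matrix m n ℝ)} (hU : IsOpen U)
    (hF : ContDiffOn ℝ ∞ F U) (hFf : EqOn F f (M ∩ U)) (hx : x ∈ M) (hxU : x ∈ U)
    {W : Matrix m n ℝ} :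
    IsRiemGradAt M f x W ↔ vec W = (1 - pinv (J x) * J x) *ᵥ vec (euclGrad F x) := by
  rw [hM.isTangentProjection.isRiemGradAt_iff hU hF hFf hx hxU, ← vec_inj, tangentProj,
    vec_matAct, kerProj]

theorem IsQuadric.isRiemHessAt_iff (hM : IsQuadric M J q) {f F : Matrix m n ℝ → ℝ}
    (hf : IsSmoothOn M f) {U : Set (Matrix m n ℝ)} (hU : IsOpen U)
    (hF : ContDiffOn ℝ ∞ F U) (hFf : EqOn F f (M ∩ U)) (hx : x ∈ M) (hxU : x ∈ U)
    (hv : v ∈ tangentSpaceAt M x) {W : Matrix m n ℝ} :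
    IsRiemHessAt M f x v W ↔
      vec W = (1 - pinv (J x) * J x) *ᵥ vec (euclHess F x v) -
        ((1 - pinv (J x) * J x) * (J v)ᵀ * (pinv (J x))ᵀ * pinv (J x) * J x) *ᵥ
          vec (euclGrad F x) := by
  rw [hM.isTangentProjection.isRiemHessAt_iff hf hU hF hFf hx hxU hv, ← vec_inj,
    hM.fderivWithin_tangentProj hx hv, tangentProj, vec_add, vec_matAct, vec_matAct, vec_matAct,
    mulVec_mulVec _ (kerProj (J x)), hM.kerProj_mul_deriv hx hv, neg_mulVec, ← sub_eq_add_neg,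
    kerProj]

end Quadric

section Indecomposable

variable {p₁ p₂ r : ℕ}

/-! ### Symmetric intertwiners of core tuples -/

/-- The normalization `∑ Aᵢ Aᵢᵀ = p₂ I`, `∑ Aᵢᵀ Aᵢ = p₁ I`. -/
def IsCore (A : Fin r → Matrix (Fin p₁) (Fin p₂) ℝ) : Prop :=
  rowGram A = (p₂ : ℝ) • 1 ∧ colGram A = (p₁ : ℝ) • 1

theorem exists_orthogonal_diagonalization {n : Type*} [Fintype n] [DecidableEq n]
    {S : Matrix n n ℝ} (hS : Sᵀ = S) : ∃ (U : Matrix n n ℝ) (d : n → ℝ), Uᵀ * U = 1 ∧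
      U * Uᵀ = 1 ∧ S = U * diagonal d * Uᵀ := by
  have hH : S.IsHermitian := by
    rw [Matrix.IsHermitian, conjTranspose_eq_transpose_of_trivial, hS]
  have h1 := Unitary.coe_star_mul_self hH.eigenvectorUnitary
  rw [star_eq_conjTranspose, conjTranspose_eq_transpose_of_trivial] at h1
  refine ⟨hH.eigenvectorUnitary, hH.eigenvalues, h1, mul_eq_one_comm.mp h1, ?_⟩
  have h := hH.spectral_theorem
  rw [Unitary.conjStarAlgAut_apply, star_eq_conjTranspose,
    conjTranspose_eq_transpose_of_trivial] at h
  exact h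

/-- Sorts a chosen set of eigenvectors to the front, because decomposability is phrased with initial
blocks of indices. -/
theorem exists_perm_lt_card_iff {p : ℕ} (s : Fin p → Prop) [DecidablePred s] :
    ∃ σ : Equiv.Perm (Fin p), ∀ i : Fin p,
      s (σ i) ↔ (i : ℕ) < (Finset.univ.filter s).card := by
  set a := (Finset.univ.filter s).card with ha
  have hap : a ≤ p := by simpa using Finset.card_filter_le Finset.univ s
  have hcard : Fintype.card {i : Fin p // (i : ℕ) < a} = Fintype.card {i : Fin p // s i} := by
    rw [Fintype.card_subtype, Fintype.card_subtype, ← ha, Fin.card_filter_val_lt, min_eq_right hap]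
  set e := Fintype.equivOfCardEq hcard
  refine ⟨e.extendSubtype, fun i => ?_⟩
  by_cases hi : (i : ℕ) < a
  · exact iff_of_true (e.extendSubtype_mem i hi) hi
  · exact iff_of_false (e.extendSubtype_not_mem i hi) hi

theorem IsCore.orthogonal_conj {A : Fin r → Matrix (Fin p₁) (Fin p₂) ℝ} (hA : IsCore A)
    {U : Matrix (Fin p₁) (Fin p₁) ℝ} {V : Matrix (Fin p₂) (Fin p₂) ℝ}
    (hU : Uᵀ * U = 1) (hU' : U * Uᵀ = 1) (hV : Vᵀ * V = 1) (hV' : V * Vᵀ = 1) :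
    IsCore fun k => Uᵀ * A k * V := by
  constructor
  · calc rowGram (fun k => Uᵀ * A k * V) = Uᵀ * rowGram A * U := by
          rw [rowGram, rowGram, Matrix.mul_sum, Matrix.sum_mul]
          refine Finset.sum_congr rfl fun k _ => ?_
          calc Uᵀ * A k * V * (Uᵀ * A k * V)ᵀ = Uᵀ * A k * (V * Vᵀ) * (A k)ᵀ * U := by
                simp only [transpose_mul, transpose_transpose, Matrix.mul_assoc]
            _ = _ := by rw [hV', Matrix.mul_one]; simp only [Matrix.mul_assoc]
      _ = _ := by rw [hA.1, Matrix.mul_smul, Matrix.mul_one, Matrix.smul_mul, hU]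
  · calc colGram (fun k => Uᵀ * A k * V) = Vᵀ * colGram A * V := by
          rw [colGram, colGram, Matrix.mul_sum, Matrix.sum_mul]
          refine Finset.sum_congr rfl fun k _ => ?_
          calc (Uᵀ * A k * V)ᵀ * (Uᵀ * A k * V) = Vᵀ * (A k)ᵀ * (U * Uᵀ) * A k * V := by
                simp only [transpose_mul, transpose_transpose, Matrix.mul_assoc]
            _ = _ := by rw [hU', Matrix.mul_one]; simp only [Matrix.mul_assoc]
      _ = _ := by rw [hA.2, Matrix.mul_smul, Matrix.mul_one, Matrix.smul_mul, hV]

/-- The two blocks of a core tuple in block form have proportional sizes. -/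
theorem IsCore.card_mul_eq {A : Fin r → Matrix (Fin p₁) (Fin p₂) ℝ} (hA : IsCore A)
    {s : Fin p₁ → Prop} {t : Fin p₂ → Prop} [DecidablePred s] [DecidablePred t]
    (h : ∀ k i j, A k i j ≠ 0 → (s i ↔ t j)) :
    p₂ * (Finset.univ.filter s).card = p₁ * (Finset.univ.filter t).card := by
  have hrow : ∀ i, ∑ k, ∑ j, A k i j * A k i j = (p₂ : ℝ) := by
    intro i
    have := congrFun (congrFun hA.1 i) i
    simpa [rowGram, Matrix.sum_apply, mul_apply] using this
  have hcol : ∀ j, ∑ k, ∑ i, A k i j * A k i j = (p₁ : ℝ) := by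
    intro j
    have := congrFun (congrFun hA.2 j) j
    simpa [colGram, Matrix.sum_apply, mul_apply] using this
  -- Double counting of the sum of squared entries: each row contributes `p₂`, each column `p₁`, and
  -- nonzero entries in the rows of `s` are exactly those in the columns of `t`.
  have e1 : ∑ i, (if s i then ∑ k, ∑ j, A k i j * A k i j else 0) =
      (p₂ : ℝ) * (Finset.univ.filter s).card := by
    simp only [hrow]
    rw [← Finset.sum_filter, Finset.sum_const, nsmul_eq_mul, mul_comm]
  have e2 : ∑ j, (if t j then ∑ k, ∑ i, A k i j * A k i j else 0) =
      (p₁ : ℝ) * (Finset.univ.filter t).card := by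
    simp only [hcol]
    rw [← Finset.sum_filter, Finset.sum_const, nsmul_eq_mul, mul_comm]
  have e3 : ∑ i, (if s i then ∑ k, ∑ j, A k i j * A k i j else 0) =
      ∑ j, (if t j then ∑ k, ∑ i, A k i j * A k i j else 0) := by
    have h1 : ∀ i, (if s i then ∑ k, ∑ j, A k i j * A k i j else 0) =
        ∑ k, ∑ j, if s i then A k i j * A k i j else 0 := by
      intro i; split_ifs <;> simp
    have h2 : ∀ j, (if t j then ∑ k, ∑ i, A k i j * A k i j else 0) =
        ∑ k, ∑ i, if t j then A k i j * A k i j else 0 := by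
      intro j; split_ifs <;> simp
    simp only [h1, h2]
    rw [Finset.sum_comm]
    conv_rhs => rw [Finset.sum_comm]
    refine Finset.sum_congr rfl fun k _ => ?_
    rw [Finset.sum_comm]
    refine Finset.sum_congr rfl fun j _ => Finset.sum_congr rfl fun i _ => ?_
    by_cases h0 : A k i j = 0
    · simp [h0]
    · simp only [h k i j h0]
  rw [e1, e2] at e3
  exact_mod_cast e3

/-- In orthonormal eigenbases of `S` and `T`, an entry of `Aₖ` can be nonzero only between equal
eigenvalues. Splitting off one eigenvalue `c` of `S` gives a block form with `p₂ a = p₁ b`, so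
either both blocks are proper, contradicting indecomposability, or `c` is the only eigenvalue of
both. -/
theorem IsCore.intertwiner_scalar (hp₁ : 0 < p₁) (hp₂ : 0 < p₂)
    {A : Fin r → Matrix (Fin p₁) (Fin p₂) ℝ} (hA : IsCore A) (hind : ¬ CanonicallyDecomposable A)
    {S : Matrix (Fin p₁) (Fin p₁) ℝ} {T : Matrix (Fin p₂) (Fin p₂) ℝ} (hS : Sᵀ = S) (hT : Tᵀ = T)
    (h : ∀ k, S * A k = A k * T) : ∃ c : ℝ, S = c • 1 ∧ T = c • 1 := by
  obtain ⟨U, d, hU, hU', hSd⟩ := exists_orthogonal_diagonalization hS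
  obtain ⟨V, e, hV, hV', hTe⟩ := exists_orthogonal_diagonalization hT
  set B : Fin r → Matrix (Fin p₁) (Fin p₂) ℝ := fun k => Uᵀ * A k * V with hB
  have hBcore : IsCore B := hA.orthogonal_conj hU hU' hV hV'
  have hcomm : ∀ k, diagonal d * B k = B k * diagonal e := by
    intro k
    calc diagonal d * (Uᵀ * A k * V) = (Uᵀ * U) * diagonal d * Uᵀ * A k * V := by
          rw [hU, Matrix.one_mul]; simp only [Matrix.mul_assoc]
      _ = Uᵀ * (S * A k) * V := by rw [hSd]; simp only [Matrix.mul_assoc]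
      _ = Uᵀ * A k * V * diagonal e * (Vᵀ * V) := by
          rw [h, hTe]; simp only [Matrix.mul_assoc]
      _ = _ := by rw [hV, Matrix.mul_one]
  have hde : ∀ k i j, B k i j ≠ 0 → d i = e j := by
    intro k i j h0
    have := congrFun (congrFun (hcomm k) i) j
    rw [diagonal_mul, mul_diagonal, mul_comm] at this
    exact mul_left_cancel₀ h0 this
  set c := d ⟨0, hp₁⟩ with hc
  have hcard := hBcore.card_mul_eq (s := fun i => d i = c) (t := fun j => e j = c)
    fun k i j h0 => by rw [hde k i j h0]
  set a := (Finset.univ.filter fun i => d i = c).card with ha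
  set b := (Finset.univ.filter fun j => e j = c).card with hb
  have ha1 : 0 < a := Finset.card_pos.mpr ⟨⟨0, hp₁⟩, by simp [hc]⟩
  have hap : a ≤ p₁ := by
    simpa using Finset.card_filter_le Finset.univ fun i => d i = c
  have hb1 : 0 < b := by
    rcases Nat.eq_zero_or_pos b with h0 | h0
    · rw [h0, mul_zero] at hcard
      exact absurd hcard (Nat.mul_pos hp₂ ha1).ne'
    · exact h0
  rcases hap.lt_or_eq with hlt | heq
  · have hbp : b < p₂ := by
      by_contra hge
      have h1 : p₂ * a < p₂ * p₁ := Nat.mul_lt_mul_of_pos_left hlt hp₂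
      have h2 : p₁ * p₂ ≤ p₁ * b := Nat.mul_le_mul_left _ (not_lt.mp hge)
      rw [mul_comm p₂ p₁] at h1
      omega
    obtain ⟨σ, hσ⟩ := exists_perm_lt_card_iff fun i => d i = c
    obtain ⟨τ, hτ⟩ := exists_perm_lt_card_iff fun j => e j = c
    have hP : ∀ {p : ℕ} {W : Matrix (Fin p) (Fin p) ℝ} (ρ : Equiv.Perm (Fin p)),
        Wᵀ * W = 1 → Wᵀ.submatrix ρ id * W.submatrix id ρ = 1 := by
      intro p W ρ hW
      rw [← submatrix_mul _ _ _ _ _ Function.bijective_id, hW, submatrix_one_equiv]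
    let P : GL (Fin p₁) ℝ := ⟨Uᵀ.submatrix σ id, U.submatrix id σ, hP σ hU,
      mul_eq_one_comm.mp (hP σ hU)⟩
    let Q : GL (Fin p₂) ℝ := ⟨Vᵀ.submatrix τ id, V.submatrix id τ, hP τ hV,
      mul_eq_one_comm.mp (hP τ hV)⟩
    refine absurd ⟨P, Q, a, b, ha1, hlt, hb1, hbp, fun k i j hij => ?_⟩ hind
    have hPQ : (P : Matrix (Fin p₁) (Fin p₁) ℝ) * A k *
        ((Q⁻¹ : GL (Fin p₂) ℝ) : Matrix (Fin p₂) (Fin p₂) ℝ) = (B k).submatrix σ τ := by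
      change Uᵀ.submatrix σ id * A k * V.submatrix id τ = _
      rw [hB, submatrix_mul _ _ _ _ _ Function.bijective_id,
        submatrix_mul _ _ _ _ _ Function.bijective_id, submatrix_id_id]
    rw [hPQ, submatrix_apply]
    by_contra h0
    have h1 := hde k _ _ h0
    have h2 := hσ i
    have h3 := hτ j
    rw [h1] at h2
    rw [h2] at h3
    omega
  · have hbp : b = p₂ := by
      rw [heq, mul_comm p₂ p₁] at hcard
      exact (Nat.eq_of_mul_eq_mul_left hp₁ hcard).symm
    have hd : diagonal d = c • 1 := by
      rw [smul_one_eq_diagonal]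
      congr 1
      funext i
      have := (Finset.card_filter_eq_iff (s := Finset.univ) (p := fun i => d i = c)).mp
        (by rw [← ha, heq]; simp)
      exact this i (Finset.mem_univ i)
    have he : diagonal e = c • 1 := by
      rw [smul_one_eq_diagonal]
      congr 1
      funext i
      have := (Finset.card_filter_eq_iff (s := Finset.univ) (p := fun i => e i = c)).mp
        (by rw [← hb, hbp]; simp)
      exact this i (Finset.mem_univ i)
    refine ⟨c, ?_, ?_⟩
    · rw [hSd, hd, Matrix.mul_smul, Matrix.mul_one, Matrix.smul_mul, hU']
    · rw [hTe, he, Matrix.mul_smul, Matrix.mul_one, Matrix.smul_mul, hV']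

theorem sum_trace_eq_of_rowGram {A : Fin r → Matrix (Fin p₁) (Fin p₂) ℝ} (hA : IsCore A)
    (R R' : Matrix (Fin p₁) (Fin p₁) ℝ) :
    ∑ k, (R * A k * (A k)ᵀ * R').trace = p₂ * (R * R').trace := by
  rw [← trace_sum, ← Matrix.sum_mul]
  simp only [Matrix.mul_assoc]
  rw [← Matrix.mul_sum, ← rowGram, hA.1]
  simp

theorem sum_trace_eq_of_colGram {A : Fin r → Matrix (Fin p₁) (Fin p₂) ℝ} (hA : IsCore A)
    (R R' : Matrix (Fin p₂) (Fin p₂) ℝ) :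
    ∑ k, (R * (A k)ᵀ * A k * R').trace = p₁ * (R * R').trace := by
  rw [← trace_sum, ← Matrix.sum_mul]
  simp only [Matrix.mul_assoc]
  rw [← Matrix.mul_sum, ← colGram, hA.2]
  simp

/-- The intertwiners of a core tuple are closed under transposition. -/
theorem IsCore.intertwiner_transpose {A : Fin r → Matrix (Fin p₁) (Fin p₂) ℝ} (hA : IsCore A)
    {S : Matrix (Fin p₁) (Fin p₁) ℝ} {T : Matrix (Fin p₂) (Fin p₂) ℝ}
    (h : ∀ k, S * A k = A k * T) (k : Fin r) : Sᵀ * A k = A k * Tᵀ := by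
  -- Both sides equal `∑ |S Aₖ|² = ∑ |Aₖ T|²`.
  have hST : (p₂ : ℝ) * (S * Sᵀ).trace = p₁ * (T * Tᵀ).trace := by
    rw [← sum_trace_eq_of_rowGram hA, ← Matrix.one_mul (T * Tᵀ), ← sum_trace_eq_of_colGram hA]
    refine Finset.sum_congr rfl fun k _ => ?_
    rw [Matrix.mul_assoc, ← transpose_mul, h, transpose_mul, ← Matrix.mul_assoc, trace_mul_comm,
      Matrix.one_mul]
    simp only [Matrix.mul_assoc]
  -- Expansion of a squared norm, with cross terms rewritten by `Aₖ T = S Aₖ`. The terms are grouped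
  -- so that each difference sums to zero over `k`, by the core normalization and `hST`.
  have hterm : ∀ k, ((Sᵀ * A k - A k * Tᵀ) * (Sᵀ * A k - A k * Tᵀ)ᵀ).trace =
      ((1 : Matrix (Fin p₂) (Fin p₂) ℝ) * (A k)ᵀ * A k * (Tᵀ * T)).trace -
        (Sᵀ * A k * (A k)ᵀ * S).trace +
        2 * ((Sᵀ * A k * (A k)ᵀ * S).trace -
          (Sᵀ * S * A k * (A k)ᵀ * (1 : Matrix (Fin p₁) (Fin p₁) ℝ)).trace) := by
    intro k
    have e1 : (Sᵀ * A k * (T * (A k)ᵀ)).trace =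
        (Sᵀ * S * A k * (A k)ᵀ * (1 : Matrix (Fin p₁) (Fin p₁) ℝ)).trace := by
      rw [Matrix.mul_one, Matrix.mul_assoc Sᵀ, Matrix.mul_assoc Sᵀ, h]
      simp only [Matrix.mul_assoc]
    have e2 : (A k * Tᵀ * ((A k)ᵀ * S)).trace = (Sᵀ * A k * (T * (A k)ᵀ)).trace := by
      rw [← trace_transpose]
      simp only [transpose_mul, transpose_transpose, Matrix.mul_assoc]
    have e3 : (A k * Tᵀ * (T * (A k)ᵀ)).trace =
        ((1 : Matrix (Fin p₂) (Fin p₂) ℝ) * (A k)ᵀ * A k * (Tᵀ * T)).trace := by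
      rw [← Matrix.mul_assoc, trace_mul_comm, Matrix.one_mul]
      simp only [Matrix.mul_assoc]
    rw [transpose_sub, transpose_mul, transpose_mul, transpose_transpose, transpose_transpose,
      Matrix.sub_mul, Matrix.mul_sub, Matrix.mul_sub, trace_sub, trace_sub, trace_sub, e2, e1, e3,
      ← Matrix.mul_assoc (Sᵀ * A k)]
    ring
  have hsum : ∑ k, ((Sᵀ * A k - A k * Tᵀ) * (Sᵀ * A k - A k * Tᵀ)ᵀ).trace = 0 := by
    simp only [hterm]
    rw [Finset.sum_add_distrib, Finset.sum_sub_distrib, ← Finset.mul_sum, Finset.sum_sub_distrib,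
      sum_trace_eq_of_rowGram hA, sum_trace_eq_of_rowGram hA, sum_trace_eq_of_colGram hA,
      Matrix.one_mul, Matrix.mul_one, trace_mul_comm Tᵀ T, ← hST, trace_mul_comm Sᵀ S]
    ring
  have hnonneg : ∀ k ∈ Finset.univ,
      0 ≤ ((Sᵀ * A k - A k * Tᵀ) * (Sᵀ * A k - A k * Tᵀ)ᵀ).trace := by
    intro k _
    rw [← conjTranspose_eq_transpose_of_trivial (Sᵀ * A k - A k * Tᵀ)]
    exact (posSemidef_self_mul_conjTranspose _).trace_nonneg
  have hk := (Finset.sum_eq_zero_iff_of_nonneg hnonneg).mp hsum k (Finset.mem_univ k)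
  rw [← conjTranspose_eq_transpose_of_trivial (Sᵀ * A k - A k * Tᵀ),
    trace_mul_conjTranspose_self_eq_zero_iff, sub_eq_zero] at hk
  exact hk

/-- Conjugating the coordinate projections onto the first blocks back by `P` and `Q` gives an
intertwining pair, in general not symmetric. Closure under transposition makes `S Sᵀ`, `T Tᵀ` a
symmetric one; it is not scalar because `S` is singular and nonzero. -/
theorem IsCore.exists_intertwiner {A : Fin r → Matrix (Fin p₁) (Fin p₂) ℝ} (hA : IsCore A)
    (hdec : CanonicallyDecomposable A) :
    ∃ (S : Matrix (Fin p₁) (Fin p₁) ℝ) (T : Matrix (Fin p₂) (Fin p₂) ℝ), Sᵀ = S ∧ Tᵀ = T ∧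
      (∀ k, S * A k = A k * T) ∧ ¬ ∃ c : ℝ, S = c • 1 := by
  obtain ⟨P, Q, a, b, ha1, hap, hb1, hbp, hPQ⟩ := hdec
  set Ea : Matrix (Fin p₁) (Fin p₁) ℝ := diagonal fun i => if (i : ℕ) < a then 1 else 0 with hEa
  set Eb : Matrix (Fin p₂) (Fin p₂) ℝ := diagonal fun j => if (j : ℕ) < b then 1 else 0 with hEb
  set Pm : Matrix (Fin p₁) (Fin p₁) ℝ := (P : Matrix (Fin p₁) (Fin p₁) ℝ) with hPm
  set Pi : Matrix (Fin p₁) (Fin p₁) ℝ :=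
    ((P⁻¹ : GL (Fin p₁) ℝ) : Matrix (Fin p₁) (Fin p₁) ℝ) with hPi
  set Qm : Matrix (Fin p₂) (Fin p₂) ℝ := (Q : Matrix (Fin p₂) (Fin p₂) ℝ) with hQm
  set Qi : Matrix (Fin p₂) (Fin p₂) ℝ :=
    ((Q⁻¹ : GL (Fin p₂) ℝ) : Matrix (Fin p₂) (Fin p₂) ℝ) with hQi
  have hPi1 : Pi * Pm = 1 := P.inv_mul
  have hPi2 : Pm * Pi = 1 := P.mul_inv
  have hQi1 : Qi * Qm = 1 := Q.inv_mul
  have hblock : ∀ k, Ea * (Pm * A k * Qi) = Pm * A k * Qi * Eb := by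
    intro k
    ext i j
    rw [hEa, hEb, diagonal_mul, mul_diagonal]
    by_cases hi : (i : ℕ) < a <;> by_cases hj : (j : ℕ) < b
    · simp [hi, hj]
    · simp [hi, hj, hPQ k i j (Or.inl ⟨hi, not_lt.mp hj⟩)]
    · simp [hi, hj, hPQ k i j (Or.inr ⟨not_lt.mp hi, hj⟩)]
    · simp [hi, hj]
  set S := Pi * Ea * Pm with hSdef
  set T := Qi * Eb * Qm with hTdef
  have hST : ∀ k, S * A k = A k * T := by
    intro k
    calc Pi * Ea * Pm * A k = Pi * Ea * Pm * A k * (Qi * Qm) := by rw [hQi1, Matrix.mul_one]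
      _ = Pi * (Ea * (Pm * A k * Qi)) * Qm := by simp only [Matrix.mul_assoc]
      _ = (Pi * Pm) * A k * Qi * Eb * Qm := by rw [hblock]; simp only [Matrix.mul_assoc]
      _ = _ := by rw [hPi1, Matrix.one_mul, hTdef]; simp only [Matrix.mul_assoc]
  refine ⟨S * Sᵀ, T * Tᵀ, by simp, by simp, fun k => ?_, ?_⟩
  · rw [Matrix.mul_assoc, hA.intertwiner_transpose hST, ← Matrix.mul_assoc, hST, Matrix.mul_assoc]
  · rintro ⟨c, hc⟩
    have hdet : S.det = 0 := by
      have : Ea.det = 0 := by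
        rw [hEa, det_diagonal]
        -- The diagonal of `Ea` vanishes at index `a`, which exists because `a < p₁`.
        exact Finset.prod_eq_zero (Finset.mem_univ ⟨a, hap⟩) (by simp)
      rw [hSdef, det_mul, det_mul, this, mul_zero, zero_mul]
    have hc0 : c = 0 := by
      have := congrArg det hc
      rw [det_mul, hdet, zero_mul, det_smul, det_one, mul_one] at this
      exact eq_zero_of_pow_eq_zero this.symm
    rw [hc0, zero_smul, ← conjTranspose_eq_transpose_of_trivial, self_mul_conjTranspose_eq_zero]
      at hc
    have hEa0 : Ea = 0 := by
      calc Ea = (Pm * Pi) * Ea * (Pm * Pi) := by rw [hPi2, Matrix.one_mul, Matrix.mul_one]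
        _ = Pm * S * Pi := by rw [hSdef]; simp only [Matrix.mul_assoc]
        _ = 0 := by rw [hc, Matrix.mul_zero, Matrix.zero_mul]
    have := congrFun (congrFun hEa0 ⟨0, by omega⟩) ⟨0, by omega⟩
    simp [hEa, Nat.lt_of_lt_of_le Nat.zero_lt_one ha1] at this

end Indecomposable

section CoreQuadric

variable {p₁ p₂ r : ℕ}

/-! ### The core manifold is a quadric -/

theorem J₁_apply (A : Fin r → Matrix (Fin p₁) (Fin p₂) ℝ) (a b i : Fin p₁) (j : Fin p₂)
    (k : Fin r) : J₁ A (a, b) (k, (j, i)) =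
      1 / ((p₁ : ℝ) * p₂) * ((if b = i then A k a j else 0) + (if a = i then A k b j else 0)) -
        2 / ((p₁ : ℝ) ^ 2 * p₂) * ((if b = a then 1 else 0) * A k i j) := by
  have h : (commMat p₁ * rowBlocks A) (a, b) (k, (j, i)) = rowBlocks A (b, a) (k, (j, i)) := by
    simp [mul_apply, commMat]
  simp only [J₁, Matrix.sub_apply, Matrix.smul_apply, Matrix.add_mul, Matrix.one_mul,
    Matrix.add_apply, h, smul_eq_mul]
  simp only [vecMulVec_apply, vec, rowBlocks, of_apply, kroneckerMap_apply, phi, Equiv.coe_fn_mk,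
    one_apply,
    mul_ite, mul_one, mul_zero]

theorem J₂_apply (A : Fin r → Matrix (Fin p₁) (Fin p₂) ℝ) (a b j : Fin p₂) (i : Fin p₁)
    (k : Fin r) : J₂ A (a, b) (k, (j, i)) =
      1 / ((p₁ : ℝ) * p₂) * ((if a = j then A k i b else 0) + (if b = j then A k i a else 0)) -
        2 / ((p₁ : ℝ) * p₂ ^ 2) * ((if b = a then 1 else 0) * A k i j) := by
  have h : (commMat p₂ * colBlocks A) (a, b) (k, (j, i)) = colBlocks A (b, a) (k, (j, i)) := by
    simp [mul_apply, commMat]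
  simp only [J₂, Matrix.sub_apply, Matrix.smul_apply, Matrix.add_mul, Matrix.one_mul,
    Matrix.add_apply, h, smul_eq_mul]
  simp only [vecMulVec_apply, vec, colBlocks, of_apply, kroneckerMap_apply, phi, Equiv.coe_fn_mk,
    one_apply,
    ite_mul, one_mul, zero_mul, transpose_apply]

theorem J₃_apply (A : Fin r → Matrix (Fin p₁) (Fin p₂) ℝ) (u : Unit) (j : Fin p₂)
    (i : Fin p₁) (k : Fin r) : J₃ A u (k, (j, i)) = 2 * A k i j := rfl

theorem constrJac_add (A B : Fin r → Matrix (Fin p₁) (Fin p₂) ℝ) :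
    constrJac (A + B) = constrJac A + constrJac B := by
  ext (⟨a, b⟩ | ⟨a, b⟩ | ⟨⟩) ⟨k, j, i⟩
  · simp only [constrJac, fromRows_apply_inl, J₁_apply, Matrix.add_apply, Pi.add_apply]
    split_ifs <;> ring
  · simp only [constrJac, fromRows_apply_inl, fromRows_apply_inr, J₂_apply, Matrix.add_apply,
      Pi.add_apply]
    split_ifs <;> ring
  · simp only [constrJac, fromRows_apply_inr, J₃_apply, Matrix.add_apply, Pi.add_apply]
    ring

theorem constrJac_smul (c : ℝ) (A : Fin r → Matrix (Fin p₁) (Fin p₂) ℝ) :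
    constrJac (c • A) = c • constrJac A := by
  ext (⟨a, b⟩ | ⟨a, b⟩ | ⟨⟩) ⟨k, j, i⟩
  · simp only [constrJac, fromRows_apply_inl, J₁_apply, Matrix.smul_apply, Pi.smul_apply,
      smul_eq_mul]
    split_ifs <;> ring
  · simp only [constrJac, fromRows_apply_inl, fromRows_apply_inr, J₂_apply, Matrix.smul_apply,
      Pi.smul_apply, smul_eq_mul]
    split_ifs <;> ring
  · simp only [constrJac, fromRows_apply_inr, J₃_apply, Matrix.smul_apply, Pi.smul_apply,
      smul_eq_mul]
    ring

/-- The constraint Jacobian as a linear map of the point. -/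
noncomputable def constrJacLin (p₁ p₂ r : ℕ) : Matrix (Fin p₂ × Fin p₁) (Fin r) ℝ →ₗ[ℝ]
    Matrix ((Fin p₁ × Fin p₁) ⊕ (Fin p₂ × Fin p₂) ⊕ Unit) (Fin r × (Fin p₂ × Fin p₁)) ℝ where
  toFun x := constrJac ((phi p₁ p₂ r).symm x)
  map_add' x y := constrJac_add ((phi p₁ p₂ r).symm x) ((phi p₁ p₂ r).symm y)
  map_smul' c x := constrJac_smul c ((phi p₁ p₂ r).symm x)

theorem constrJacLin_apply (x : Matrix (Fin p₂ × Fin p₁) (Fin r) ℝ) :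
    constrJacLin p₁ p₂ r x = constrJac ((phi p₁ p₂ r).symm x) := rfl

/-- The Euclidean inner product of two tuples. -/
def tupleInner (A B : Fin r → Matrix (Fin p₁) (Fin p₂) ℝ) : ℝ := ∑ k, ∑ j, ∑ i, A k i j * B k i j

theorem tupleInner_comm (A B : Fin r → Matrix (Fin p₁) (Fin p₂) ℝ) :
    tupleInner A B = tupleInner B A := by
  simp only [tupleInner, mul_comm]

theorem tupleInner_self (A : Fin r → Matrix (Fin p₁) (Fin p₂) ℝ) :
    tupleInner A A = (rowGram A).trace := by
  simp only [tupleInner, rowGram, Matrix.trace_sum]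
  refine Finset.sum_congr rfl fun k _ => ?_
  rw [Finset.sum_comm]
  simp [Matrix.trace, mul_apply]

theorem constrJac_mulVec_row (A B : Fin r → Matrix (Fin p₁) (Fin p₂) ℝ) (a b : Fin p₁) :
    (constrJac A *ᵥ vec (phi p₁ p₂ r B)) (Sum.inl (a, b)) =
      1 / ((p₁ : ℝ) * p₂) * ∑ k, ∑ j, (A k a j * B k b j + B k a j * A k b j) -
        2 / ((p₁ : ℝ) ^ 2 * p₂) * ((if b = a then 1 else 0) * tupleInner A B) := by
  simp only [mulVec, dotProduct, constrJac, fromRows_apply_inl, Fintype.sum_prod_type, J₁_apply,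
    vec, phi, Equiv.coe_fn_mk, of_apply, tupleInner, Finset.mul_sum]
  simp only [← Finset.sum_sub_distrib]
  refine Finset.sum_congr rfl fun k _ => Finset.sum_congr rfl fun j _ => ?_
  simp only [sub_mul, mul_add, add_mul, Finset.sum_sub_distrib, Finset.sum_add_distrib, mul_ite,
    ite_mul, mul_zero, zero_mul, Finset.sum_ite_eq, Finset.mem_univ, if_true]
  congr 1
  · ring
  · refine Finset.sum_congr rfl fun i _ => ?_
    split_ifs <;> ring

theorem constrJac_mulVec_col (A B : Fin r → Matrix (Fin p₁) (Fin p₂) ℝ) (a b : Fin p₂) :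
    (constrJac A *ᵥ vec (phi p₁ p₂ r B)) (Sum.inr (Sum.inl (a, b))) =
      1 / ((p₁ : ℝ) * p₂) * ∑ k, ∑ i, (A k i a * B k i b + B k i a * A k i b) -
        2 / ((p₁ : ℝ) * p₂ ^ 2) * ((if b = a then 1 else 0) * tupleInner A B) := by
  simp only [mulVec, dotProduct, constrJac, fromRows_apply_inl, fromRows_apply_inr,
    Fintype.sum_prod_type, J₂_apply, vec, phi, Equiv.coe_fn_mk, of_apply, tupleInner,
    Finset.mul_sum]
  simp only [← Finset.sum_sub_distrib]
  refine Finset.sum_congr rfl fun k _ => ?_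
  rw [Finset.sum_comm]
  conv_rhs => enter [2]; rw [Finset.sum_comm]
  rw [← Finset.sum_sub_distrib]
  refine Finset.sum_congr rfl fun i _ => ?_
  simp only [sub_mul, mul_add, add_mul, Finset.sum_sub_distrib, Finset.sum_add_distrib, mul_ite,
    ite_mul, mul_zero, zero_mul, Finset.sum_ite_eq, Finset.mem_univ, if_true]
  congr 1
  · ring
  · refine Finset.sum_congr rfl fun j _ => ?_
    split_ifs <;> ring

theorem constrJac_mulVec_unit (A B : Fin r → Matrix (Fin p₁) (Fin p₂) ℝ) :
    (constrJac A *ᵥ vec (phi p₁ p₂ r B)) (Sum.inr (Sum.inr ())) = 2 * tupleInner A B := by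
  simp only [mulVec, dotProduct, constrJac, fromRows_apply_inr, Fintype.sum_prod_type, J₃_apply,
    vec, phi, Equiv.coe_fn_mk, of_apply, tupleInner, Finset.mul_sum, mul_assoc]

theorem constrJac_mulVec_comm (A B : Fin r → Matrix (Fin p₁) (Fin p₂) ℝ) :
    constrJac A *ᵥ vec (phi p₁ p₂ r B) = constrJac B *ᵥ vec (phi p₁ p₂ r A) := by
  ext (⟨a, b⟩ | ⟨a, b⟩ | ⟨⟩)
  · rw [constrJac_mulVec_row, constrJac_mulVec_row, tupleInner_comm]
    simp only [mul_comm, add_comm]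
  · rw [constrJac_mulVec_col, constrJac_mulVec_col, tupleInner_comm]
    simp only [mul_comm, add_comm]
  · rw [constrJac_mulVec_unit, constrJac_mulVec_unit, tupleInner_comm]

/-- The value of the quadratic constraints on the core manifold. -/
def coreValue (p₁ p₂ : ℕ) : (Fin p₁ × Fin p₁) ⊕ (Fin p₂ × Fin p₂) ⊕ Unit → ℝ :=
  Sum.elim 0 (Sum.elim 0 fun _ => 2 * (p₁ * p₂))

theorem rowGram_apply (A : Fin r → Matrix (Fin p₁) (Fin p₂) ℝ) (a b : Fin p₁) :
    rowGram A a b = ∑ k, ∑ j, A k a j * A k b j := by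
  simp [rowGram, Matrix.sum_apply, mul_apply]

theorem colGram_apply (A : Fin r → Matrix (Fin p₁) (Fin p₂) ℝ) (a b : Fin p₂) :
    colGram A a b = ∑ k, ∑ i, A k i a * A k i b := by
  simp [colGram, Matrix.sum_apply, mul_apply]

/-- The last equation fixes the total trace at `p₁p₂`; the others then say that each Gram matrix is
its trace part. On the diagonal `J(A) vec(A)` doubles the trace, whence the value `2p₁p₂`. -/
theorem constrJac_mulVec_self_eq_iff (hp₁ : 0 < p₁) (hp₂ : 0 < p₂)
    (A : Fin r → Matrix (Fin p₁) (Fin p₂) ℝ) :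
    constrJac A *ᵥ vec (phi p₁ p₂ r A) = coreValue p₁ p₂ ↔ IsCore A := by
  have h1 : (p₁ : ℝ) ≠ 0 := by positivity
  have h2 : (p₂ : ℝ) ≠ 0 := by positivity
  have hrow : ∀ a b, (constrJac A *ᵥ vec (phi p₁ p₂ r A)) (Sum.inl (a, b)) =
      2 / ((p₁ : ℝ) * p₂) * (rowGram A a b -
        (if b = a then 1 else 0) * (tupleInner A A / p₁)) := by
    intro a b
    rw [constrJac_mulVec_row, rowGram_apply]
    simp only [← two_mul, ← Finset.mul_sum]
    field_simp
  have hcol : ∀ a b, (constrJac A *ᵥ vec (phi p₁ p₂ r A)) (Sum.inr (Sum.inl (a, b))) =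
      2 / ((p₁ : ℝ) * p₂) * (colGram A a b -
        (if b = a then 1 else 0) * (tupleInner A A / p₂)) := by
    intro a b
    rw [constrJac_mulVec_col, colGram_apply]
    simp only [← two_mul, ← Finset.mul_sum]
    field_simp
  constructor
  · intro h
    have hs : tupleInner A A = p₁ * p₂ := by
      have := congrFun h (Sum.inr (Sum.inr ()))
      rw [constrJac_mulVec_unit] at this
      simp only [coreValue, Sum.elim_inr] at this
      linarith
    constructor
    · ext a b
      have := congrFun h (Sum.inl (a, b))
      rw [hrow, hs] at this
      simp only [coreValue, Sum.elim_inl, Pi.zero_apply, mul_eq_zero] at this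
      have := this.resolve_left (by positivity)
      rw [sub_eq_zero] at this
      rw [this, Matrix.smul_apply, one_apply, smul_eq_mul, mul_div_cancel_left₀ _ h1, mul_comm]
      simp only [eq_comm]
    · ext a b
      have := congrFun h (Sum.inr (Sum.inl (a, b)))
      rw [hcol, hs] at this
      simp only [coreValue, Sum.elim_inl, Sum.elim_inr, Pi.zero_apply, mul_eq_zero] at this
      have := this.resolve_left (by positivity)
      rw [sub_eq_zero] at this
      rw [this, Matrix.smul_apply, one_apply, smul_eq_mul, mul_div_cancel_right₀ _ h2, mul_comm]
      simp only [eq_comm]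
  · intro h
    have hs : tupleInner A A = p₁ * p₂ := by
      rw [tupleInner_self, h.1]
      simp [mul_comm]
    ext (⟨a, b⟩ | ⟨a, b⟩ | ⟨⟩)
    · rw [hrow, hs, h.1, mul_div_cancel_left₀ _ h1]
      simp [coreValue, one_apply, eq_comm]
    · rw [hcol, hs, h.2, mul_div_cancel_right₀ _ h2]
      simp [coreValue, one_apply, eq_comm]
    · rw [constrJac_mulVec_unit, hs]
      rfl

/-! ### The adjoint of the Jacobian and symmetric intertwiners -/

/-- The symmetric matrix acting on the left in the transpose of the constraint Jacobian. -/
noncomputable def dualLeft (z : (Fin p₁ × Fin p₁) ⊕ (Fin p₂ × Fin p₂) ⊕ Unit → ℝ) :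
    Matrix (Fin p₁) (Fin p₁) ℝ :=
  Matrix.of fun i a => 1 / ((p₁ : ℝ) * p₂) * (z (Sum.inl (a, i)) + z (Sum.inl (i, a))) +
    (if i = a then 2 * z (Sum.inr (Sum.inr ())) -
      2 / ((p₁ : ℝ) ^ 2 * p₂) * (∑ b, z (Sum.inl (b, b))) -
      2 / ((p₁ : ℝ) * p₂ ^ 2) * (∑ b, z (Sum.inr (Sum.inl (b, b)))) else 0)

/-- The symmetric matrix acting on the right in the transpose of the constraint Jacobian. -/
noncomputable def dualRight (z : (Fin p₁ × Fin p₁) ⊕ (Fin p₂ × Fin p₂) ⊕ Unit → ℝ) :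
    Matrix (Fin p₂) (Fin p₂) ℝ :=
  Matrix.of fun b j => 1 / ((p₁ : ℝ) * p₂) *
    (z (Sum.inr (Sum.inl (j, b))) + z (Sum.inr (Sum.inl (b, j))))

theorem transpose_dualLeft (z : (Fin p₁ × Fin p₁) ⊕ (Fin p₂ × Fin p₂) ⊕ Unit → ℝ) :
    (dualLeft z)ᵀ = dualLeft z := by
  ext i a
  simp only [dualLeft, transpose_apply, of_apply, eq_comm (a := a), add_comm (z (Sum.inl (a, i)))]

theorem transpose_dualRight (z : (Fin p₁ × Fin p₁) ⊕ (Fin p₂ × Fin p₂) ⊕ Unit → ℝ) :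
    (dualRight z)ᵀ = dualRight z := by
  ext i a
  simp only [dualRight, transpose_apply, of_apply, add_comm (z (Sum.inr (Sum.inl (a, i))))]

theorem sum_J₁_mul (A : Fin r → Matrix (Fin p₁) (Fin p₂) ℝ) (w : Fin p₁ × Fin p₁ → ℝ) (k : Fin r)
    (j : Fin p₂) (i : Fin p₁) : ∑ a, ∑ b, J₁ A (a, b) (k, (j, i)) * w (a, b) =
      ∑ a, 1 / ((p₁ : ℝ) * p₂) * (w (a, i) + w (i, a)) * A k a j -
        2 / ((p₁ : ℝ) ^ 2 * p₂) * (∑ b, w (b, b)) * A k i j := by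
  simp only [J₁_apply, sub_mul, mul_add, add_mul, Finset.sum_sub_distrib, Finset.sum_add_distrib,
    ite_mul, mul_ite, mul_zero, zero_mul, one_mul, Finset.sum_ite_eq',
    Finset.mem_univ, if_true]
  congr 2
  · exact Finset.sum_congr rfl fun a _ => by ring
  · rw [Finset.sum_comm]
    simp only [Finset.sum_ite_eq', Finset.mem_univ, if_true]
    exact Finset.sum_congr rfl fun a _ => by ring
  · rw [Finset.mul_sum, Finset.sum_mul]
    exact Finset.sum_congr rfl fun a _ => by ring

theorem sum_J₂_mul (A : Fin r → Matrix (Fin p₁) (Fin p₂) ℝ) (w : Fin p₂ × Fin p₂ → ℝ) (k : Fin r)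
    (j : Fin p₂) (i : Fin p₁) : ∑ a, ∑ b, J₂ A (a, b) (k, (j, i)) * w (a, b) =
      ∑ a, A k i a * (1 / ((p₁ : ℝ) * p₂) * (w (j, a) + w (a, j))) -
        2 / ((p₁ : ℝ) * p₂ ^ 2) * (∑ b, w (b, b)) * A k i j := by
  simp only [J₂_apply, sub_mul, mul_add, add_mul, Finset.sum_sub_distrib, Finset.sum_add_distrib,
    ite_mul, mul_ite, mul_zero, zero_mul, one_mul, Finset.sum_ite_eq',
    Finset.mem_univ, if_true]
  congr 2
  · rw [Finset.sum_comm]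
    simp only [Finset.sum_ite_eq', Finset.mem_univ, if_true]
    exact Finset.sum_congr rfl fun a _ => by ring
  · exact Finset.sum_congr rfl fun a _ => by ring
  · rw [Finset.mul_sum, Finset.sum_mul]
    exact Finset.sum_congr rfl fun a _ => by ring

/-- Translates dependencies of the constraints into intertwiners. All rank-one corrections with
`aᵀ`, and the last row, contribute multiples of `Aₖ` and are collected in the diagonal of
`dualLeft`. -/
theorem transpose_constrJac_mulVec (A : Fin r → Matrix (Fin p₁) (Fin p₂) ℝ)
    (z : (Fin p₁ × Fin p₁) ⊕ (Fin p₂ × Fin p₂) ⊕ Unit → ℝ) (k : Fin r) (j : Fin p₂) (i : Fin p₁) :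
    ((constrJac A)ᵀ *ᵥ z) (k, (j, i)) = (dualLeft z * A k + A k * dualRight z) i j := by
  simp only [mulVec, dotProduct, transpose_apply, Fintype.sum_sum_type, Fintype.sum_prod_type,
    constrJac, fromRows_apply_inl, fromRows_apply_inr, J₃_apply, Finset.univ_unique,
    Finset.sum_singleton, Matrix.add_apply, mul_apply, dualLeft, dualRight, of_apply]
  rw [sum_J₁_mul A fun q => z (Sum.inl q), sum_J₂_mul A fun q => z (Sum.inr (Sum.inl q))]
  simp only [add_mul (_ * _), ite_mul, zero_mul, Finset.sum_add_distrib, Finset.sum_ite_eq,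
    Finset.mem_univ, if_true]
  change _ + (_ + 2 * A k i j * z (Sum.inr (Sum.inr ()))) = _
  ring

theorem transpose_constrJac_mulVec_eq_zero_iff (A : Fin r → Matrix (Fin p₁) (Fin p₂) ℝ)
    (z : (Fin p₁ × Fin p₁) ⊕ (Fin p₂ × Fin p₂) ⊕ Unit → ℝ) :
    (constrJac A)ᵀ *ᵥ z = 0 ↔ ∀ k, dualLeft z * A k = A k * -dualRight z := by
  constructor
  · intro h k
    rw [Matrix.mul_neg, ← add_eq_zero_iff_eq_neg]
    ext i j
    rw [← transpose_constrJac_mulVec, h]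
    rfl
  · intro h
    ext ⟨k, j, i⟩
    rw [transpose_constrJac_mulVec, h, Matrix.mul_neg, neg_add_cancel]
    rfl

theorem exists_dual (hp₁ : 0 < p₁) (hp₂ : 0 < p₂) {S : Matrix (Fin p₁) (Fin p₁) ℝ}
    {T : Matrix (Fin p₂) (Fin p₂) ℝ} (hS : Sᵀ = S) (hT : Tᵀ = T) :
    ∃ z, dualLeft z = S ∧ dualRight z = T := by
  have h1 : (p₁ : ℝ) ≠ 0 := by positivity
  have h2 : (p₂ : ℝ) ≠ 0 := by positivity
  have hS' : ∀ i a, S a i = S i a := fun i a => congrFun (congrFun hS i) a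
  have hT' : ∀ i a, T a i = T i a := fun i a => congrFun (congrFun hT i) a
  -- The factor `p₁p₂/2` undoes the symmetrization and the scaling by `1/(p₁p₂)`; the last
  -- coordinate cancels the two trace corrections.
  refine ⟨Sum.elim (fun q => p₁ * p₂ / 2 * S q.1 q.2) (Sum.elim (fun q => p₁ * p₂ / 2 * T q.1 q.2)
    fun _ => 1 / ((p₁ : ℝ) ^ 2 * p₂) * (∑ b, p₁ * p₂ / 2 * S b b) +
      1 / ((p₁ : ℝ) * p₂ ^ 2) * (∑ b, p₁ * p₂ / 2 * T b b)), ?_, ?_⟩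
  · ext i a
    simp only [dualLeft, of_apply, Sum.elim_inl, Sum.elim_inr, hS' i a]
    have : ∀ x y : ℝ, 2 * (1 / ((p₁ : ℝ) ^ 2 * p₂) * x + 1 / ((p₁ : ℝ) * p₂ ^ 2) * y) -
        2 / ((p₁ : ℝ) ^ 2 * p₂) * x - 2 / ((p₁ : ℝ) * p₂ ^ 2) * y = 0 := by
      intro x y; ring
    rw [this]
    simp only [ite_self, add_zero]
    field_simp
    ring
  · ext i a
    simp only [dualRight, of_apply, Sum.elim_inl, Sum.elim_inr, hT' i a]
    field_simp
    ring

/-! ### Membership in the core manifold and its local equations -/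

theorem mapF_eq_iff (hp₁ : 0 < p₁) (hp₂ : 0 < p₂) (A : Fin r → Matrix (Fin p₁) (Fin p₂) ℝ) :
    mapF A = ((p₁ : ℝ)⁻¹ • 1, (p₂ : ℝ)⁻¹ • 1, (p₁ : ℝ) * p₂) ↔ IsCore A := by
  have h1 : (p₁ : ℝ) ≠ 0 := by positivity
  have h2 : (p₂ : ℝ) ≠ 0 := by positivity
  simp only [mapF, Prod.mk.injEq]
  constructor
  · rintro ⟨hr, hc, ht⟩
    rw [ht, inv_smul_eq_iff₀ (mul_ne_zero h1 h2), smul_smul] at hr hc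
    refine ⟨hr.trans ?_, hc.trans ?_⟩ <;> congr 1 <;> field_simp
  · rintro ⟨hr, hc⟩
    have ht : (rowGram A).trace = p₁ * p₂ := by rw [hr]; simp [mul_comm]
    rw [ht, hr, hc, smul_smul, smul_smul]
    refine ⟨?_, ?_, rfl⟩ <;> congr 1 <;> field_simp

theorem mem_coreManifold_iff (hp₁ : 0 < p₁) (hp₂ : 0 < p₂) (hrp : r ≤ p₁ * p₂)
    (x : Matrix (Fin p₂ × Fin p₁) (Fin r) ℝ) :
    x ∈ coreManifold p₁ p₂ r ↔ x.rank = r ∧ IsCore ((phi p₁ p₂ r).symm x) ∧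
      ¬ CanonicallyDecomposable ((phi p₁ p₂ r).symm x) := by
  rw [coreManifold, Equiv.image_eq_preimage_symm, mem_preimage, setD, mem_ofPred_eq,
    mapF_eq_iff hp₁ hp₂, setH, mem_ofPred_eq, Equiv.apply_symm_apply, min_eq_right hrp]
  refine ⟨fun ⟨⟨h1, _, _, h2⟩, h3⟩ => ⟨h1, h3, h2⟩, fun ⟨h1, h3, h2⟩ => ⟨⟨h1, ?_, ?_, h2⟩, h3⟩⟩
  · have hu : IsUnit ((p₂ : ℝ) • (1 : Matrix (Fin p₁) (Fin p₁) ℝ)) := by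
      rw [isUnit_iff_isUnit_det, det_smul, det_one, mul_one, isUnit_iff_ne_zero]
      positivity
    rw [h3.1, rank_of_isUnit _ hu, Fintype.card_fin]
  · have hu : IsUnit ((p₁ : ℝ) • (1 : Matrix (Fin p₂) (Fin p₂) ℝ)) := by
      rw [isUnit_iff_isUnit_det, det_smul, det_one, mul_one, isUnit_iff_ne_zero]
      positivity
    rw [h3.2, rank_of_isUnit _ hu, Fintype.card_fin]

theorem rank_eq_iff_isUnit_gram {m n : Type*} [Fintype m] [Fintype n] [DecidableEq n]
    (x : Matrix m n ℝ) : x.rank = Fintype.card n ↔ IsUnit (xᵀ * x) := by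
  rw [← rank_transpose_mul_self]
  refine ⟨fun h => ?_, rank_of_isUnit _⟩
  rw [← mulVec_surjective_iff_isUnit, ← coe_mulVecLin, ← LinearMap.range_eq_top]
  apply Submodule.eq_top_of_finrank_eq
  rw [Module.finrank_fintype_fun_eq_card]
  exact h

attribute [local instance] frobeniusUniformSpace frobeniusTopologicalSpace

/-- Intertwiners at a point are scalar pairs `(c, c)`, which intertwine every tuple; this gives the
kernel condition. Openness combines full rank with upper semicontinuity of the kernel of `J(y)ᵀ`. -/
theorem isQuadric_coreManifold (hp₁ : 0 < p₁) (hp₂ : 0 < p₂) (hrp : r ≤ p₁ * p₂) :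
    IsQuadric (coreManifold p₁ p₂ r) (constrJacLin p₁ p₂ r) (coreValue p₁ p₂) := by
  have heqn : ∀ x : Matrix (Fin p₂ × Fin p₁) (Fin r) ℝ,
      constrJacLin p₁ p₂ r x *ᵥ vec x = coreValue p₁ p₂ ↔ IsCore ((phi p₁ p₂ r).symm x) :=
    fun x => constrJac_mulVec_self_eq_iff hp₁ hp₂ ((phi p₁ p₂ r).symm x)
  have hscalar : ∀ x ∈ coreManifold p₁ p₂ r, ∀ z, (constrJacLin p₁ p₂ r x)ᵀ *ᵥ z = 0 →
      ∃ c : ℝ, dualLeft z = c • 1 ∧ -dualRight z = c • 1 := by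
    intro x hx z hz
    obtain ⟨-, hcore, hind⟩ := (mem_coreManifold_iff hp₁ hp₂ hrp x).mp hx
    rw [constrJacLin_apply, transpose_constrJac_mulVec_eq_zero_iff] at hz
    exact hcore.intertwiner_scalar hp₁ hp₂ hind (transpose_dualLeft z)
      (by rw [transpose_neg, transpose_dualRight]) hz
  have hker : ∀ x ∈ coreManifold p₁ p₂ r, ∀ z, (constrJacLin p₁ p₂ r x)ᵀ *ᵥ z = 0 →
      ∀ y, (constrJacLin p₁ p₂ r y)ᵀ *ᵥ z = 0 := by
    intro x hx z hz y
    obtain ⟨c, hS, hT⟩ := hscalar x hx z hz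
    rw [constrJacLin_apply, transpose_constrJac_mulVec_eq_zero_iff]
    intro k
    simp [hS, hT]
  refine ⟨fun x y => constrJac_mulVec_comm ((phi p₁ p₂ r).symm x) ((phi p₁ p₂ r).symm y),
    fun x hx => (heqn x).mpr ((mem_coreManifold_iff hp₁ hp₂ hrp x).mp hx).2.1,
    fun x hx => ?_, hker⟩
  have hJ : Continuous (constrJacLin p₁ p₂ r) :=
    LinearMap.continuous_of_finiteDimensional _
  have hT : Continuous fun y : Matrix (Fin p₂ × Fin p₁) (Fin r) ℝ => yᵀ := transposeCLM.continuous
  refine ⟨{y | IsUnit (constrJacLin p₁ p₂ r y * (constrJacLin p₁ p₂ r y)ᵀ +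
      cokerProj (constrJacLin p₁ p₂ r x))} ∩ {y | IsUnit (yᵀ * yᵀᵀ)},
    (isOpen_setOf_isUnit_comp ((continuous_gram hJ).add continuous_const)).inter
      (isOpen_setOf_isUnit_comp (continuous_gram hT)), ⟨?_, ?_⟩, ?_⟩
  · exact isUnit_gram_add_cokerProj fun z hz => hz
  · have h := ((mem_coreManifold_iff hp₁ hp₂ hrp x).mp hx).1
    rw [mem_ofPred_eq, transpose_transpose, ← rank_eq_iff_isUnit_gram, h, Fintype.card_fin]
  · rintro y ⟨hy1, hy2⟩ hyq
    rw [mem_ofPred_eq, transpose_transpose, ← rank_eq_iff_isUnit_gram, Fintype.card_fin] at hy2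
    refine (mem_coreManifold_iff hp₁ hp₂ hrp y).mpr ⟨hy2, (heqn y).mp hyq, fun hdec => ?_⟩
    -- A decomposable solution `y` near `x` would put a nonscalar intertwiner into `ker J(y)ᵀ`,
    -- which lies in `ker J(x)ᵀ`, where all are scalar.
    obtain ⟨S, T, hS, hT, hST, hns⟩ := ((heqn y).mp hyq).exists_intertwiner hdec
    obtain ⟨z, hzS, hzT⟩ := exists_dual hp₁ hp₂ hS (T := -T) (by rw [transpose_neg, hT])
    have hyz : (constrJacLin p₁ p₂ r y)ᵀ *ᵥ z = 0 := by
      rw [constrJacLin_apply, transpose_constrJac_mulVec_eq_zero_iff, hzS, hzT, neg_neg]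
      exact hST
    have hxz : (constrJacLin p₁ p₂ r x)ᵀ *ᵥ z = 0 :=
      ker_le_of_isUnit_gram_add_cokerProj
        (transpose_mul_cokerProj_of_ker_le fun w hw => hker x hx w hw y) hy1 hyz
    obtain ⟨c, hc, -⟩ := hscalar x hx z hxz
    exact hns ⟨c, hzS ▸ hc⟩

end CoreQuadric

end KronCore

/-! ### The gradient and Hessian formulas -/

theorem proposition5p3 (p₁ p₂ r : ℕ)
    (hr : (p₁ : ℝ) / p₂ + (p₂ : ℝ) / p₁ < r) (hrp : r ≤ p₁ * p₂)
    (f : Matrix (Fin p₂ × Fin p₁) (Fin r) ℝ → ℝ)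
    (hf : IsSmoothOn (coreManifold p₁ p₂ r) f)
    (A : Matrix (Fin p₂ × Fin p₁) (Fin r) ℝ) (hA : A ∈ coreManifold p₁ p₂ r)
    (At : Fin r → Matrix (Fin p₁) (Fin p₂) ℝ) (hAt : At = (phi p₁ p₂ r).symm A)
    (U : Set (Matrix (Fin p₂ × Fin p₁) (Fin r) ℝ)) (hU : IsOpen U) (hAU : A ∈ U)
    (F : Matrix (Fin p₂ × Fin p₁) (Fin r) ℝ → ℝ) (hF : ContDiffOn ℝ ∞ F U)
    (hFf : EqOn F f (coreManifold p₁ p₂ r ∩ U)) :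
    (∀ W : Matrix (Fin p₂ × Fin p₁) (Fin r) ℝ,
      IsRiemGradAt (coreManifold p₁ p₂ r) f A W ↔
        vec W = (1 - pinv (constrJac At) * constrJac At) *ᵥ vec (euclGrad F A)) ∧
    (∀ V ∈ tangentSpaceAt (coreManifold p₁ p₂ r) A,
      ∀ Vt : Fin r → Matrix (Fin p₁) (Fin p₂) ℝ, Vt = (phi p₁ p₂ r).symm V →
        ∀ W : Matrix (Fin p₂ × Fin p₁) (Fin r) ℝ,
          IsRiemHessAt (coreManifold p₁ p₂ r) f A V W ↔
            vec W = (1 - pinv (constrJac At) * constrJac At) *ᵥ vec (euclHess F A V) -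
              ((1 - pinv (constrJac At) * constrJac At) * (constrJac Vt)ᵀ * (pinv (constrJac At))ᵀ * pinv (constrJac At) * constrJac At) *ᵥ
                vec (euclGrad F A)) := by
  -- The quotients are nonnegative even for `p₁ = 0` or `p₂ = 0`, where division by zero gives zero.
  -- So `r > 0`, and `r ≤ p₁p₂` makes `p₁` and `p₂` positive.
  have hr0 : 0 < r := by
    rcases Nat.eq_zero_or_pos r with h | h
    · subst h
      have : (0 : ℝ) ≤ (p₁ : ℝ) / p₂ + (p₂ : ℝ) / p₁ := by positivity
      simp only [Nat.cast_zero] at hr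
      linarith
    · exact h
  have hp : 0 < p₁ * p₂ := hr0.trans_le hrp
  have hM := isQuadric_coreManifold (r := r) (Nat.pos_of_mul_pos_right hp)
    (Nat.pos_of_mul_pos_left hp) hrp
  subst hAt
  refine ⟨fun W => hM.isRiemGradAt_iff hU hF hFf hA hAU, ?_⟩
  rintro V hV Vt rfl W
  exact hM.isRiemHessAt_iff hf hU hF hFf hA hAU hV
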